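/- Setting. An instance consists of mutually independent random variables $P_1,\dots,P_n$, a finite indexed collection $\mathcal A$ of events, each determined by the variables, and a subset $\mathcal A'\subseteq\mathcal A$ (the core). For an event $A$ let $\mathrm{vbl}(A)$ be the smallest set of variables that determines $A$, and let $\Gamma(A)$ be the set of all $B\in\mathcal A$, $B\ne A$, with $\mathrm{vbl}(A)\cap\mathrm{vbl}(B)\neq\emptyset$. The modified Moser–Tardos (MT) algorithm samples all the variables independently; while some event of $\mathcal A'$ holds under the current assignment, it chooses such an event arbitrarily and resamples the variables of $\mathrm{vbl}$ of this event independently; it stops when no event of $\mathcal A'$ holds, and outputs the current assignment. An assignment is good if no event of $\mathcal A$ holds under it. An execution uses as $k$-th sample of $P_i$ the entry $(i,k)$ of a table of independent samples; all statements below about the algorithm hold simultaneously for all ways of making the arbitrary choices (the number of resamplings is read as its supremum over all these ways). Consider a family of instances with a size parameter that is at least $n$; each instance is presented by a finite bit string, and the values of its variables are encoded by finite bit strings. The programs are those of a multi-stack machine that reads the presentation and the current values bit by bit, has an instruction that draws a fresh sample of a variable, and takes one step per instruction or test. The cores are efficiently verifiable if one program, in a number of steps polynomial in the size and without drawing samples,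 given an arbitrary assignment finds an event $A\in\mathcal A'$ that holds (and reports $\mathrm{vbl}(A)$) or detects that there is none. Theorem. There is an absolute constant $C>0$ such that the following holds for every such family whose cores are efficiently verifiable. (i) The modified MT algorithm can be efficiently implemented: there are one program and one polynomial $q$ such that, for every instance and every table of samples for which the number of resamplings is finite, the program carries out a complete execution of the modified MT algorithm, stops with its output as the values of the variables, and takes at most $q(\text{size})\cdot(N+1)$ steps, where $N$ is the number of resamplings of this execution. (ii) Let an instance of the family, $\varepsilon\in[0,1)$ and $x:\mathcal A\to(0,1)$ be such that $$\forall A\in\mathcal A:\quad \Pr[A]\le(1-\varepsilon)\,x(A)\prod_{B\in\Gamma(A)\cap\mathcal A'}(1-x(B)).$$ Put $T=\sum_{A\in\mathcal A'}x(A)$ and $\delta=\min_{A\in\mathcal A'}x(A)\prod_{B\in\Gamma(A)\cap\mathcal A'}(1-x(B))$, and let $\log$ be the logarithm to base $2$. Then: - if $\mathrm{vbl}(A)\ne\emptyset$ for all $A\in\mathcal A'$ (and $\mathcal A'\neq\emptyset$), then $T\le n\max\{1,\log(1/\delta)\}$; - if $\varepsilon=0$, then the expected number of resamplings is at most $v_1=T\max_{A\in\mathcal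 A'}\frac1{1-x(A)}$ (read as $0$ if $\mathcal A'=\emptyset$), and for every $\lambda\ge1$ the algorithm terminates within $\lambda v_1$ resamplings with probability at least $1-1/\lambda$; - if $\varepsilon>0$, then the expected number of resamplings is at most $v_2=C\,\frac n\varepsilon\log\!\left(2+\frac T\varepsilon\right)$, and for every $\lambda\ge1$ the algorithm terminates within $\lambda v_2$ resamplings with probability at least $1-e^{-\lambda}$; - with probability at least $1-\sum_{A\in\mathcal A\setminus\mathcal A'}x(A)$ the algorithm terminates and outputs a good assignment. -/

import Mathlib

open MeasureTheory
open scoped ENNReal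

universe u v w

/-! ## The variable framework of the Lovász Local Lemma -/

/-- `n` mutually independent random variables (variable `i` takes values in `Ω i` and has law `μ i`),
a finite indexed collection `event` of bad events, and a subset `core` of it. -/
structure LLLInstance where
  n : ℕ
  Ω : Fin n → Type u
  mΩ : ∀ i, MeasurableSpace (Ω i)
  μ : ∀ i, @Measure (Ω i) (mΩ i)
  prob : ∀ i, @IsProbabilityMeasure (Ω i) (mΩ i) (μ i)
  J : Type v
  fin : Fintype J
  event : J → Set (∀ i, Ω i)
  meas : ∀ j, MeasurableSet (event j)
  core : Finset J

namespace LLLInstance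

attribute [instance] LLLInstance.mΩ LLLInstance.prob LLLInstance.fin

/-- Assignments of values to the variables. -/
abbrev Assignment (I : LLLInstance.{u, v}) : Type u := ∀ i, I.Ω i

/-- The set `B` of assignments is determined by the variables in `S`. -/
def DeterminedBy (I : LLLInstance.{u, v}) (S : Finset (Fin I.n)) (B : Set I.Assignment) : Prop :=
  ∀ ω ω' : I.Assignment, (∀ i ∈ S, ω i = ω' i) → (ω ∈ B ↔ ω' ∈ B)

open Classical in
/-- The smallest set of variables that determines `B` (see `determinedBy_vblSet`): the intersection
of all the determining sets. -/
noncomputable def vblSet (I : LLLInstance.{u, v}) (B : Set I.Assignment) : Finset (Fin I.n) :=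
  Finset.univ.filter fun i => ∀ S, I.DeterminedBy S B → i ∈ S

theorem DeterminedBy.inter (I : LLLInstance.{u, v}) {S T : Finset (Fin I.n)}
    {B : Set I.Assignment} (hS : I.DeterminedBy S B) (hT : I.DeterminedBy T B) :
    I.DeterminedBy (S ∩ T) B := by
  classical
  intro ω ω' h
  have h1 := hS ω (fun i => if i ∈ S then ω i else ω' i) (fun i hi => by simp [hi])
  have h2 := hT (fun i => if i ∈ S then ω i else ω' i) ω' (fun i hi => by
    by_cases hs : i ∈ S
    · simpa [hs] using h i (Finset.mem_inter.2 ⟨hs, hi⟩)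
    · simp [hs])
  exact h1.trans h2

theorem determinedBy_vblSet (I : LLLInstance.{u, v}) (B : Set I.Assignment) :
    I.DeterminedBy (I.vblSet B) B := by
  classical
  have key : ∀ F : Finset (Finset (Fin I.n)), (∀ S ∈ F, I.DeterminedBy S B) →
      I.DeterminedBy (F.inf id) B := by
    intro F
    induction F using Finset.induction_on with
    | empty =>
      intro _ ω ω' h
      have : ω = ω' := funext fun i => h i (by simp)
      rw [this]
    | insert S F _ ih =>
      intro h
      rw [Finset.inf_insert]
      exact DeterminedBy.inter I (h S (by simp)) (ih fun T hT => h T (by simp [hT]))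
  have h := key (Finset.univ.filter fun S => I.DeterminedBy S B) (by simp)
  have e : (Finset.univ.filter fun S => I.DeterminedBy S B).inf id = I.vblSet B := by
    ext i
    simp [vblSet, Finset.mem_inf]
  rwa [e] at h

/-- The variables that the bad event `j` depends on. -/
noncomputable def vbl (I : LLLInstance.{u, v}) (j : I.J) : Finset (Fin I.n) :=
  I.vblSet (I.event j)

open Classical in
/-- `Γ(j) ∩ core`: the core events other than `j` that share a variable with `j`. -/
noncomputable def coreNbr (I : LLLInstance.{u, v}) (j : I.J) : Finset I.J :=
  I.core.filter fun k => k ≠ j ∧ (I.vbl k ∩ I.vbl j).Nonempty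

open Classical in
/-- The bad events outside the core. -/
noncomputable def nonCore (I : LLLInstance.{u, v}) : Finset I.J :=
  Finset.univ \ I.core

/-- The probability of the bad event `j` when the variables are sampled independently. -/
noncomputable def probOf (I : LLLInstance.{u, v}) (j : I.J) : ℝ :=
  (Measure.pi I.μ).real (I.event j)

/-! ## The modified Moser–Tardos algorithm, which resamples core events only -/

/-- The random source: `R (i, k)` is the `k`-th sample drawn for variable `i`. -/
abbrev Table (I : LLLInstance.{u, v}) : Type u := ∀ p : Fin I.n × ℕ, I.Ω p.1

/-- The law of the random source: all samples are independent, those for variable `i` have law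
`μ i`. -/
noncomputable def tableLaw (I : LLLInstance.{u, v}) : Measure I.Table :=
  Measure.infinitePi fun p : Fin I.n × ℕ => I.μ p.1

open Classical in
/-- How often variable `i` is resampled if the events in the list `l` are resampled. -/
noncomputable def resampleCount (I : LLLInstance.{u, v}) (l : List I.J) (i : Fin I.n) : ℕ :=
  l.countP fun j => decide (i ∈ I.vbl j)

/-- The current assignment after the events in the list `l` have been resampled: every variable
has its most recent sample (sample number `0` is the initial one). -/
noncomputable def current (I : LLLInstance.{u, v}) (R : I.Table) (l : List I.J) : I.Assignment :=
  fun i => R (i, I.resampleCount l i)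

/-- `l` (latest event first) is the log of the resamplings of a possible partial execution of the
algorithm with the random source `R`: in every step, an arbitrary core event that holds currently
is chosen, and all the variables that it depends on are resampled. -/
inductive IsLog (I : LLLInstance.{u, v}) (R : I.Table) : List I.J → Prop
  | nil : IsLog I R []
  | cons (l : List I.J) (j : I.J) (hl : IsLog I R l) (hj : j ∈ I.core)
      (holds : I.current R l ∈ I.event j) : IsLog I R (j :: l)

/-- `l` is the log of a terminated execution: no core event holds any more. -/
def IsFinalLog (I : LLLInstance.{u, v}) (R : I.Table) (l : List I.J) : Prop :=
  I.IsLog R l ∧ ∀ j ∈ I.core, I.current R l ∉ I.event j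

/-- The number of resamplings of the algorithm with the random source `R`. The algorithm may choose
arbitrarily among the core events that hold; this is the supremum over all ways to choose, so that
it bounds the number of resamplings under every rule of choice. -/
noncomputable def resamplings (I : LLLInstance.{u, v}) (R : I.Table) : ℕ∞ :=
  ⨆ l : {l : List I.J // I.IsLog R l}, (l.1.length : ℕ∞)

/-- The random sources with which the algorithm terminates and outputs a good assignment (one that
avoids all bad events, core or not), however it chooses among the core events that hold. -/
def successSet (I : LLLInstance.{u, v}) : Set I.Table :=
  {R | I.resamplings R < ⊤ ∧ ∀ l, I.IsFinalLog R l → ∀ j, I.current R l ∉ I.event j}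

/-! ## Quantities in the running time -/

/-- The sum of `x` over the core. -/
noncomputable def T (I : LLLInstance.{u, v}) (x : I.J → ℝ) : ℝ := ∑ j ∈ I.core, x j

/-- The minimum over core events `j` of `x j * ∏ (1 - x k)`, over the core neighbours `k` of `j`. -/
noncomputable def δ (I : LLLInstance.{u, v}) (x : I.J → ℝ) : ℝ :=
  ⨅ j : I.core, x j * ∏ k ∈ I.coreNbr j, (1 - x k)

/-- The bound without slack. -/
noncomputable def v₁ (I : LLLInstance.{u, v}) (x : I.J → ℝ) : ℝ :=
  I.T x * ⨆ j : I.core, 1 / (1 - x j)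

/-- The bound with slack `ε`, up to a constant factor. The `2 +` only keeps the logarithm
positive: for `T / ε ≥ 2` it changes the bound by a factor of at most two. -/
noncomputable def v₂ (I : LLLInstance.{u, v}) (x : I.J → ℝ) (ε : ℝ) : ℝ :=
  I.n / ε * Real.logb 2 (2 + I.T x / ε)

end LLLInstance

/-! ## A machine model with a step count

Structured programs on finitely many stacks of bits (a multitape Turing machine up to a polynomial
in the number of steps), with bitwise read access to a description of the instance and to the
current values of the variables, and with an instruction that draws a fresh sample of a variable.
A number that an instruction takes is the height of a stack. -/

/-- Tests: the stack `s` is nonempty, or has the bit `true` on top. -/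
inductive StackTest
  | nonempty (s : ℕ)
  | top (s : ℕ)

/-- Programs. Stacks are named by natural numbers; every program names finitely many of them. -/
inductive Prog
  | skip
  | push (s : ℕ) (b : Bool)
  | pop (s : ℕ)
  /-- push on `s` the bit of the description at position `height of a`, if there is one -/
  | readInput (s a : ℕ)
  /-- push on `s` the bit at position `height of b` of the value of the variable with number
  `height of a`, if there is one -/
  | readValue (s a b : ℕ)
  /-- push on `s` whether the height of `a` is the number of a variable -/
  | isVar (s a : ℕ)
  /-- draw a fresh sample of the variable with number `height of a`, if there is one -/
  | sample (a : ℕ)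
  | seq (p q : Prog)
  | ite (t : StackTest) (p q : Prog)
  | while (t : StackTest) (p : Prog)

/-- A representation of an instance by bit strings: a description of the instance, and an encoding
of the values of each variable. -/
structure Presentation (I : LLLInstance.{u, v}) where
  desc : List Bool
  enc : ∀ i, I.Ω i → List Bool

/-- Machine states: the stacks (top first), the current values of the variables, and the number of
samples drawn of each variable. -/
structure MState (I : LLLInstance.{u, v}) where
  stk : ℕ → List Bool
  val : I.Assignment
  drawn : Fin I.n → ℕ

namespace MState

variable {I : LLLInstance.{u, v}}

/-- The state with empty stacks. -/
def blank (ω : I.Assignment) (d : Fin I.n → ℕ) : MState I := ⟨fun _ => [], ω, d⟩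

def setStk (σ : MState I) (s : ℕ) (l : List Bool) : MState I :=
  { σ with stk := Function.update σ.stk s l }

def pushOpt (σ : MState I) (s : ℕ) (b : Option Bool) : MState I :=
  σ.setStk s (b.toList ++ σ.stk s)

/-- The bit at position `k` of the value of the variable number `a`. -/
def valueBit (P : Presentation I) (σ : MState I) (a k : ℕ) : Option Bool :=
  if h : a < I.n then (P.enc ⟨a, h⟩ (σ.val ⟨a, h⟩))[k]? else none

/-- Replace the value of the variable number `a` by its next sample from the random source. -/
def draw (R : I.Table) (σ : MState I) (a : ℕ) : MState I :=
  if h : a < I.n then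
    { σ with
      val := Function.update σ.val ⟨a, h⟩ (R (⟨a, h⟩, σ.drawn ⟨a, h⟩))
      drawn := Function.update σ.drawn ⟨a, h⟩ (σ.drawn ⟨a, h⟩ + 1) }
  else σ

end MState

def StackTest.eval {I : LLLInstance.{u, v}} (σ : MState I) : StackTest → Bool
  | .nonempty s => !(σ.stk s).isEmpty
  | .top s => (σ.stk s).head? == some true

/-- `Runs P R p σ t σ'`: started in the state `σ`, the program `p` halts after `t` steps in the
state `σ'`. Every instruction and every evaluation of a test takes one step. -/
inductive Runs {I : LLLInstance.{u, v}} (P : Presentation I) (R : I.Table) :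
    Prog → MState I → ℕ → MState I → Prop
  | skip (σ : MState I) : Runs P R .skip σ 1 σ
  | push (s : ℕ) (b : Bool) (σ : MState I) : Runs P R (.push s b) σ 1 (σ.pushOpt s (some b))
  | pop (s : ℕ) (σ : MState I) : Runs P R (.pop s) σ 1 (σ.setStk s (σ.stk s).tail)
  | readInput (s a : ℕ) (σ : MState I) :
      Runs P R (.readInput s a) σ 1 (σ.pushOpt s P.desc[(σ.stk a).length]?)
  | readValue (s a b : ℕ) (σ : MState I) :
      Runs P R (.readValue s a b) σ 1
        (σ.pushOpt s (σ.valueBit P (σ.stk a).length (σ.stk b).length))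
  | isVar (s a : ℕ) (σ : MState I) :
      Runs P R (.isVar s a) σ 1 (σ.pushOpt s (some (decide ((σ.stk a).length < I.n))))
  | sample (a : ℕ) (σ : MState I) : Runs P R (.sample a) σ 1 (σ.draw R (σ.stk a).length)
  | seq (p q : Prog) (σ σ₁ σ₂ : MState I) (t₁ t₂ : ℕ) (hp : Runs P R p σ t₁ σ₁)
      (hq : Runs P R q σ₁ t₂ σ₂) : Runs P R (.seq p q) σ (t₁ + t₂) σ₂
  | iteTrue (c : StackTest) (p q : Prog) (σ σ' : MState I) (t : ℕ) (hc : c.eval σ = true)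
      (hp : Runs P R p σ t σ') : Runs P R (.ite c p q) σ (1 + t) σ'
  | iteFalse (c : StackTest) (p q : Prog) (σ σ' : MState I) (t : ℕ) (hc : c.eval σ = false)
      (hq : Runs P R q σ t σ') : Runs P R (.ite c p q) σ (1 + t) σ'
  | whileFalse (c : StackTest) (p : Prog) (σ : MState I) (hc : c.eval σ = false) :
      Runs P R (.while c p) σ 1 σ
  | whileTrue (c : StackTest) (p : Prog) (σ σ₁ σ₂ : MState I) (t₁ t₂ : ℕ) (hc : c.eval σ = true)
      (hp : Runs P R p σ t₁ σ₁) (hw : Runs P R (.while c p) σ₁ t₂ σ₂) :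
      Runs P R (.while c p) σ (1 + t₁ + t₂) σ₂

/-! ## Efficient verifiability and efficient implementation -/

open Classical in
/-- On every assignment, and from empty stacks, the program `V` halts within `t` steps without
having drawn samples, and either finds a core event that holds or detects that there is none. It
answers with the top bit of stack `0`; the event that it finds is reported by the bit vector, on
stack `1`, of the set of variables that it depends on. -/
def FindsCoreEvent {I : LLLInstance.{u, v}} (P : Presentation I) (V : Prog) (t : ℕ) : Prop :=
  ∀ (R : I.Table) (ω : I.Assignment) (d : Fin I.n → ℕ), ∃ (k : ℕ) (σ : MState I),
    k ≤ t ∧ Runs P R V (MState.blank ω d) k σ ∧ σ.val = ω ∧ σ.drawn = d ∧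
    ((∃ j ∈ I.core, ω ∈ I.event j ∧ (σ.stk 0).head? = some true ∧
        σ.stk 1 = List.ofFn fun i => decide (i ∈ I.vbl j)) ∨
      ((∀ j ∈ I.core, ω ∉ I.event j) ∧ (σ.stk 0).head? ≠ some true))

/-- The cores of a family of instances are efficiently verifiable: one program, in a number of
steps that is polynomial in the size, finds a core event that holds or detects that none does. -/
def EfficientlyVerifiable {ι : Type w} (F : ι → LLLInstance.{u, v})
    (P : ∀ a, Presentation (F a)) (size : ι → ℕ) : Prop :=
  ∃ (V : Prog) (p : Polynomial ℕ), ∀ a, FindsCoreEvent (P a) V (p.eval (size a))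

/-- The modified Moser–Tardos algorithm can be efficiently implemented on a family of instances:
one program, from any initial values of the variables, carries out a complete execution of the
algorithm and stops with its output as the values of the variables, in a number of steps that is at
most a polynomial in the size, times one plus the number of resamplings of that execution. -/
def EfficientlyImplementable {ι : Type w} (F : ι → LLLInstance.{u, v})
    (P : ∀ a, Presentation (F a)) (size : ι → ℕ) : Prop :=
  ∃ (M : Prog) (q : Polynomial ℕ), ∀ (a : ι) (R : (F a).Table) (ω₀ : (F a).Assignment),
    (F a).resamplings R < ⊤ →
    ∃ (l : List (F a).J) (t : ℕ) (σ : MState (F a)), (F a).IsFinalLog R l ∧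
      Runs (P a) R M (MState.blank ω₀ fun _ => 0) t σ ∧ σ.val = (F a).current R l ∧
      t ≤ q.eval (size a) * (l.length + 1)

/-! Fix the table of samples. When an event `a` holds after a core log `l`, only its causal past
matters. Resamplings without a common variable commute, so `a :: l` can be reordered into events
independent of `a`, which come last in time, and before them a stack of layers headed by `{a}`, each
consisting of core events that depend on the layer listed just before it (`exists_history`).
Dropping the independent events leaves a consistent layered history of `a`.

A given list of events is consistent with a random table with probability exactly the product of the
event probabilities, because each check reads fresh samples (`tableLaw_consistent`). Put `y = x / (1
- x)`, so that `1 + y = 1 / (1 - x)`. For core events `b` the local condition becomes `Pr[b] * ∏ (1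
+ y c) ≤ y b`, the product running over all core events dependent on `b`, itself included. Expanding
such products over subsets, an induction on the number of layers bounds the total weight of the
histories of `a` (`tsum_tails_le`) by `y a` if `a` is in the core, and by `x a` otherwise, since
then `a` is not one of the factors.

The `k`-th resampling of `a` has a history with exactly `k` copies of `a`, so different resamplings
have different histories. The expected number of resamplings is therefore at most the sum of `y`
over the core, and Markov's inequality gives the tail bound. A union bound over the events outside
the core gives the quality of the output.

With slack, a history of length at least `s` carries an additional factor `(1 - η) ^ s`. More than
`n * t` resamplings force some variable to be resampled more than `t` times, and the last event that
does so has a history with more than `t` events. Half of the slack pays for this decay; the other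
half pays for scaling `x` away from `1`, which bounds the sum of `y` by `2 * T / ε`.

For the bound on `T`, the core events containing a fixed variable are pairwise neighbours, so the
quantity minimized in `δ`, taken at the one with least `x`, already contains a factor for each of
the others.

For the implementation, one round redraws the variables given by a bit vector, empties the stacks
and runs the verifier. Stack heights are bounded by running times, so a round takes polynomial time.
-/

namespace LLLInstance

variable (I : LLLInstance.{u, v})

/-! ## Traces: logs up to the order of independent resamplings -/

/-- Two events are dependent if they are equal or share a variable. -/
def Dep (a b : I.J) : Prop := a = b ∨ (I.vbl a ∩ I.vbl b).Nonempty

/-- Every event in the list holds at the time at which it is resampled. -/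
def Consistent (R : I.Table) : List I.J → Prop
  | [] => True
  | j :: l => I.current R l ∈ I.event j ∧ Consistent R l

/-- The lists `l` and `l'` are permutations of each other that are consistent with the same random
sources, after any common past. -/
def TraceEq (l l' : List I.J) : Prop :=
  l.Perm l' ∧ ∀ (R : I.Table) (m : List I.J), I.Consistent R (l ++ m) ↔ I.Consistent R (l' ++ m)

variable {I}

theorem consistent_cons {R : I.Table} {j : I.J} {l : List I.J} :
    I.Consistent R (j :: l) ↔ I.current R l ∈ I.event j ∧ I.Consistent R l := Iff.rfl

theorem dep_refl (a : I.J) : I.Dep a a := Or.inl rfl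

theorem dep_comm {a b : I.J} : I.Dep a b ↔ I.Dep b a := by
  unfold Dep
  rw [Finset.inter_comm, eq_comm]

theorem isLog_iff {R : I.Table} {l : List I.J} :
    I.IsLog R l ↔ I.Consistent R l ∧ ∀ j ∈ l, j ∈ I.core := by
  constructor
  · intro h
    induction h with
    | nil => exact ⟨trivial, by simp⟩
    | cons l j hl hj holds ih => exact ⟨⟨holds, ih.1⟩, by simpa using ⟨hj, ih.2⟩⟩
  · rintro ⟨h, hc⟩
    induction l with
    | nil => exact .nil
    | cons j l ih =>
      exact .cons l j (ih h.2 fun k hk => hc k (by simp [hk])) (hc j (by simp)) h.1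

theorem Consistent.of_append {R : I.Table} {l m : List I.J} (h : I.Consistent R (l ++ m)) :
    I.Consistent R m := by
  induction l with
  | nil => exact h
  | cons a l ih => exact ih h.2

theorem resampleCount_perm {l l' : List I.J} (h : l.Perm l') :
    I.resampleCount l = I.resampleCount l' := by
  funext i
  exact h.countP_eq _

theorem current_perm (R : I.Table) {l l' : List I.J} (h : l.Perm l') :
    I.current R l = I.current R l' := by
  unfold current
  rw [resampleCount_perm h]

theorem resampleCount_cons (j : I.J) (l : List I.J) (i : Fin I.n) :
    I.resampleCount (j :: l) i = I.resampleCount l i + if i ∈ I.vbl j then 1 else 0 := by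
  simp [resampleCount, List.countP_cons]

theorem current_cons_mem_event {R : I.Table} {a b : I.J} (h : ¬ I.Dep a b) (l : List I.J) :
    I.current R (b :: l) ∈ I.event a ↔ I.current R l ∈ I.event a := by
  refine I.determinedBy_vblSet (I.event a) _ _ fun i hi => ?_
  have hb : i ∉ I.vbl b := fun hb => h (Or.inr ⟨i, Finset.mem_inter.2 ⟨hi, hb⟩⟩)
  have := resampleCount_cons b l i
  rw [if_neg hb, add_zero] at this
  exact congrArg (β := I.Ω i) (fun k : ℕ => R (i, k)) this

namespace TraceEq

theorem refl (l : List I.J) : I.TraceEq l l := ⟨.refl _, fun _ _ => Iff.rfl⟩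

theorem symm {l l' : List I.J} (h : I.TraceEq l l') : I.TraceEq l' l :=
  ⟨h.1.symm, fun R m => (h.2 R m).symm⟩

theorem trans {l₁ l₂ l₃ : List I.J} (h : I.TraceEq l₁ l₂) (h' : I.TraceEq l₂ l₃) :
    I.TraceEq l₁ l₃ :=
  ⟨h.1.trans h'.1, fun R m => (h.2 R m).trans (h'.2 R m)⟩

theorem append_right {l l' : List I.J} (h : I.TraceEq l l') (m : List I.J) :
    I.TraceEq (l ++ m) (l' ++ m) :=
  ⟨h.1.append_right m, fun R k => by simpa using h.2 R (m ++ k)⟩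

/-- The current assignment depends only on the multiset of past resamplings; this is why `TraceEq`
includes `List.Perm`. -/
theorem cons {l l' : List I.J} (h : I.TraceEq l l') (a : I.J) :
    I.TraceEq (a :: l) (a :: l') :=
  ⟨h.1.cons a, fun R m => by
    rw [List.cons_append, List.cons_append, consistent_cons, consistent_cons,
      current_perm R (h.1.append_right m)]
    exact and_congr_right fun _ => h.2 R m⟩

theorem append_left {l l' : List I.J} (h : I.TraceEq l l') (m : List I.J) :
    I.TraceEq (m ++ l) (m ++ l') := by
  induction m with
  | nil => exact h
  | cons a m ih => exact ih.cons a

theorem swap {a b : I.J} (h : ¬ I.Dep a b) (l : List I.J) :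
    I.TraceEq (a :: b :: l) (b :: a :: l) := by
  refine ⟨.swap _ _ _, fun R m => ?_⟩
  simp only [List.cons_append, consistent_cons]
  rw [current_cons_mem_event h,
    current_cons_mem_event (mt dep_comm.1 h)]
  tauto

/-- Lists have the latest event first, so this moves the oldest event past everything that came
after it. -/
theorem append_singleton {b : I.J} {l : List I.J} (h : ∀ c ∈ l, ¬ I.Dep b c) :
    I.TraceEq (l ++ [b]) (b :: l) := by
  induction l with
  | nil => exact refl _
  | cons c l ih =>
    exact ((ih fun d hd => h d (by simp [hd])).cons c).trans
      (swap (mt dep_comm.1 (h c (by simp))) l)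

theorem of_perm {l l' : List I.J} (h : l.Perm l') (hl : l.Pairwise fun a b => ¬ I.Dep a b) :
    I.TraceEq l l' := by
  induction h with
  | nil => exact refl _
  | cons a _ ih => exact (ih hl.of_cons).cons a
  | swap a b l =>
    refine swap ?_ l
    simp only [List.pairwise_cons, List.mem_cons, forall_eq_or_imp] at hl
    exact hl.1.1
  | trans h₁ _ ih₁ ih₂ =>
    exact (ih₁ hl).trans (ih₂ (h₁.pairwise hl fun h => mt dep_comm.1 h))

end TraceEq

/-! ## Layered histories -/

variable (I) in
open Classical in
/-- The core events that depend on an event in `L`. -/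
noncomputable def coreDep (L : Finset I.J) : Finset I.J :=
  I.core.filter fun b => ∃ a ∈ L, I.Dep b a

variable (I) in
/-- `M` may follow `L` as a layer of a history. -/
def Follows (L M : Finset I.J) : Prop := M.Nonempty ∧ M ⊆ I.coreDep L

/-- The events of a layered history (latest layer first), as a list. -/
noncomputable def flat (τ : List (Finset I.J)) : List I.J := (τ.map Finset.toList).flatten

@[simp] theorem flat_nil : flat ([] : List (Finset I.J)) = [] := rfl

@[simp] theorem flat_cons (L : Finset I.J) (τ : List (Finset I.J)) :
    flat (L :: τ) = L.toList ++ flat τ := by simp [flat]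

theorem coreDep_mono {L M : Finset I.J} (h : L ⊆ M) : I.coreDep L ⊆ I.coreDep M := by
  intro b
  simp only [coreDep, Finset.mem_filter]
  rintro ⟨hb, a, ha, hab⟩
  exact ⟨hb, a, h ha, hab⟩

variable (I) in
/-- No two events in `L` depend on each other. -/
def IndepSet (L : Finset I.J) : Prop := ∀ a ∈ L, ∀ b ∈ L, a ≠ b → ¬ I.Dep a b

open Classical in
theorem indepSet_insert {M : Finset I.J} (h : I.IndepSet M) {b : I.J}
    (hb : ∀ c ∈ M, ¬ I.Dep b c) : I.IndepSet (insert b M) := by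
  intro a ha c hc hac
  rw [Finset.mem_insert] at ha hc
  rcases ha with rfl | ha <;> rcases hc with rfl | hc
  · exact absurd rfl hac
  · exact hb c hc
  · exact mt dep_comm.1 (hb a ha)
  · exact h a ha c hc hac

theorem IndepSet.pairwise_toList {M : Finset I.J} (h : I.IndepSet M) :
    M.toList.Pairwise fun a b => ¬ I.Dep a b := by
  refine List.Pairwise.imp_of_mem ?_ (Finset.nodup_toList M)
  intro a b ha hb hab
  exact h a (by simpa using ha) b (by simpa using hb) hab

open Classical in
theorem IndepSet.insert_traceEq {M : Finset I.J} (h : I.IndepSet M) {b : I.J}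
    (hb : ∀ c ∈ M, ¬ I.Dep b c) : I.TraceEq (b :: M.toList) (insert b M).toList := by
  have hbM : b ∉ M := fun hm => hb b hm (dep_refl b)
  refine (TraceEq.of_perm (Finset.toList_insert hbM) ?_).symm
  exact (indepSet_insert h hb).pairwise_toList

/-- An event that precedes a layered history either is independent of it or can be absorbed. -/
theorem absorb {b : I.J} (hb : b ∈ I.core) (L : Finset I.J) (τ : List (Finset I.J))
    (hτ : (L :: τ).IsChain I.Follows) (hi : ∀ M ∈ L :: τ, I.IndepSet M) :
    (∀ c ∈ flat (L :: τ), ¬ I.Dep b c) ∨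
    ∃ τ', (L :: τ').IsChain I.Follows ∧ (∀ M ∈ L :: τ', I.IndepSet M) ∧
      I.TraceEq (flat (L :: τ) ++ [b]) (flat (L :: τ')) := by
  classical
  have hfol : ∀ M : Finset I.J, M ⊆ I.coreDep L → (∃ c ∈ L, I.Dep b c) →
      I.Follows L (insert b M) := by
    rintro M hM ⟨c, hc, hbc⟩
    refine ⟨Finset.insert_nonempty _ _, Finset.insert_subset ?_ hM⟩
    simpa [coreDep] using ⟨hb, c, hc, hbc⟩
  -- The event `b` is older than all the layers. It is first offered to the deeper layers; if they
  -- are independent of it, it commutes past them and joins the layer right below `L`, provided that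
  -- `L` contains an event dependent on it.
  induction τ generalizing L with
  | nil =>
    by_cases hL : ∃ c ∈ L, I.Dep b c
    · right
      refine ⟨[{b}], ?_, ?_, ?_⟩
      · simpa using hfol ∅ (by simp) hL
      · intro M hM
        simp only [List.mem_cons, List.not_mem_nil, or_false] at hM
        rcases hM with rfl | rfl
        · exact hi _ (by simp)
        · intro a ha c hc hac
          simp only [Finset.mem_singleton] at ha hc
          exact absurd (ha.trans hc.symm) hac
      · simpa using TraceEq.refl _
    · left
      push Not at hL
      simpa using hL
  | cons M τ ih =>
    have hτ' : (M :: τ).IsChain I.Follows := hτ.tail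
    have hi' : ∀ K ∈ M :: τ, I.IndepSet K := fun K hK => hi K (List.mem_cons_of_mem _ hK)
    have hLM : I.Follows L M := by
      simpa using (List.isChain_cons_cons.1 hτ).1
    have hfol' : ∀ K : Finset I.J, K ⊆ I.coreDep M → (∃ c ∈ M, I.Dep b c) →
        I.Follows M (insert b K) := by
      rintro K hK ⟨c, hc, hbc⟩
      refine ⟨Finset.insert_nonempty _ _, Finset.insert_subset ?_ hK⟩
      simpa [coreDep] using ⟨hb, c, hc, hbc⟩
    rcases ih M hτ' hi' hfol' with h | ⟨τ', h₁, h₂, h₃⟩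
    · have hM : ∀ c ∈ M, ¬ I.Dep b c := fun c hc => h c (by simp [hc])
      by_cases hL : ∃ c ∈ L, I.Dep b c
      · right
        refine ⟨insert b M :: τ, ?_, ?_, ?_⟩
        · rw [List.isChain_cons_cons]
          refine ⟨hfol M hLM.2 hL, ?_⟩
          cases τ with
          | nil => simp
          | cons K τ =>
            rw [List.isChain_cons_cons] at hτ' ⊢
            -- Enlarging a layer only weakens the requirement on the layer below it.
            exact ⟨⟨hτ'.1.1, hτ'.1.2.trans (coreDep_mono (Finset.subset_insert _ _))⟩, hτ'.2⟩
        · intro K hK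
          simp only [List.mem_cons] at hK
          rcases hK with rfl | rfl | hK
          · exact hi _ (by simp)
          · exact indepSet_insert (hi M (by simp)) hM
          · exact hi K (by simp [hK])
        · have e₁ := TraceEq.append_singleton h
          have e₂ := ((hi M (by simp)).insert_traceEq hM).append_right (flat τ)
          have e₃ := (e₁.trans (by simpa using e₂)).append_left L.toList
          simpa using e₃
      · left
        push Not at hL
        intro c hc
        rw [flat_cons, List.mem_append, Finset.mem_toList] at hc
        exact hc.elim (hL c) (h c)
    · right
      refine ⟨M :: τ', ?_, ?_, ?_⟩
      · rw [List.isChain_cons_cons]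
        exact ⟨hLM, h₁⟩
      · intro K hK
        rw [List.mem_cons] at hK
        rcases hK with rfl | hK
        · exact hi _ (by simp)
        · exact h₂ K hK
      · simpa using h₃.append_left L.toList

/-- The history of the latest event in a list: the list can be reordered so that it consists of
events that do not depend on the latest one, preceded by a layered history of the latest one. -/
theorem exists_history (a : I.J) (l : List I.J) (hl : ∀ j ∈ l, j ∈ I.core) :
    ∃ (τ : List (Finset I.J)) (d : List I.J), ({a} :: τ).IsChain I.Follows ∧
      I.TraceEq (a :: l) (d ++ flat ({a} :: τ)) ∧ ∀ c ∈ d, ¬ I.Dep a c := by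
  -- Independence within each layer is needed only here, to reorder a layer when an event is
  -- inserted; the later summation does without it.
  suffices h : ∃ (τ : List (Finset I.J)) (d : List I.J), ({a} :: τ).IsChain I.Follows ∧
      (∀ M ∈ {a} :: τ, I.IndepSet M) ∧
      I.TraceEq (a :: l) (d ++ flat ({a} :: τ)) ∧ ∀ c ∈ d, ¬ I.Dep a c by
    obtain ⟨τ, d, h₁, _, h₂⟩ := h
    exact ⟨τ, d, h₁, h₂⟩
  -- The past is extended backwards in time, one older event `b` at a time: `b` is absorbed into a
  -- layer or joins the independent part `d`.
  induction l using List.reverseRecOn with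
  | nil =>
    refine ⟨[], [], by simp, ?_, by simpa using TraceEq.refl _, by simp⟩
    intro M hM b hb c hc hbc
    simp only [List.mem_cons, List.not_mem_nil, or_false] at hM
    subst hM
    simp only [Finset.mem_singleton] at hb hc
    exact absurd (hb.trans hc.symm) hbc
  | append_singleton l b ih =>
    obtain ⟨τ, d, h₁, h₂, h₃, h₄⟩ := ih fun j hj => hl j (by simp [hj])
    have h₅ := h₃.append_right [b]
    rcases absorb (hl b (by simp)) {a} τ h₁ h₂ with h | ⟨τ', h₁', h₂', h₃'⟩
    · refine ⟨τ, d ++ [b], h₁, h₂, ?_, ?_⟩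
      · have := (TraceEq.append_singleton h).append_left d
        simpa using h₅.trans (by simpa using this)
      · intro c hc
        rw [List.mem_append, List.mem_singleton] at hc
        rcases hc with hc | rfl
        · exact h₄ c hc
        · exact mt dep_comm.1 (h a (by simp))
    · refine ⟨τ', d, h₁', h₂', ?_, h₄⟩
      have := h₃'.append_left d
      simpa using h₅.trans (by simpa using this)

end LLLInstance

namespace LLLInstance

variable {I : LLLInstance.{u, v}}

/-! ## The probability that a list of events is consistent with the random source -/

instance : IsProbabilityMeasure I.tableLaw := by
  unfold tableLaw
  infer_instance

/-- The σ-algebra generated by the samples with numbers in `S`. -/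
@[reducible]
def samplesIn (I : LLLInstance.{u, v}) (S : Set (Fin I.n × ℕ)) : MeasurableSpace I.Table :=
  ⨆ p ∈ S, MeasurableSpace.comap (fun R : I.Table => R p) (I.mΩ p.1)

theorem samplesIn_mono {S S' : Set (Fin I.n × ℕ)} (h : S ⊆ S') :
    I.samplesIn S ≤ I.samplesIn S' :=
  biSup_mono h

theorem samplesIn_le (S : Set (Fin I.n × ℕ)) : I.samplesIn S ≤ MeasurableSpace.pi :=
  iSup₂_le fun p _ => (measurable_pi_apply p).comap_le

theorem measurable_sample {S : Set (Fin I.n × ℕ)} {p : Fin I.n × ℕ} (hp : p ∈ S) :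
    Measurable[I.samplesIn S] (fun R : I.Table => R p) :=
  measurable_iff_comap_le.2
    (le_biSup (fun p => MeasurableSpace.comap (fun R : I.Table => R p) (I.mΩ p.1)) hp)

theorem indep_samplesIn {S S' : Set (Fin I.n × ℕ)} (h : Disjoint S S') :
    ProbabilityTheory.Indep (I.samplesIn S) (I.samplesIn S') I.tableLaw := by
  have hi : ProbabilityTheory.iIndepFun (fun p (R : I.Table) => R p) I.tableLaw :=
    ProbabilityTheory.iIndepFun_infinitePi (P := fun p : Fin I.n × ℕ => I.μ p.1)
      (X := fun _ ω => ω) (by fun_prop)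
  exact ProbabilityTheory.indep_iSup_of_disjoint
    (fun p => (measurable_pi_apply p).comap_le) hi h

instance : Nonempty I.Assignment :=
  ⟨fun i => (nonempty_of_isProbabilityMeasure (I.μ i)).some⟩

/-- The event is unaffected by freezing all the variables outside `vbl j` at a fixed assignment, so
only the current samples of `vbl j` are read. -/
theorem measurableSet_current_mem (l : List I.J) (j : I.J) :
    MeasurableSet[I.samplesIn {p | p.1 ∈ I.vbl j ∧ p.2 = I.resampleCount l p.1}]
      {R | I.current R l ∈ I.event j} := by
  classical
  obtain ⟨ω⟩ := (inferInstance : Nonempty I.Assignment)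
  let S : Set (Fin I.n × ℕ) := {p | p.1 ∈ I.vbl j ∧ p.2 = I.resampleCount l p.1}
  let f : I.Table → I.Assignment := fun R i =>
    if i ∈ I.vbl j then R (i, I.resampleCount l i) else ω i
  have hf : Measurable[I.samplesIn S] f := by
    refine (@measurable_pi_iff _ _ _ (I.samplesIn S) _ f).2 fun i => ?_
    by_cases hi : i ∈ I.vbl j
    · simp only [f, if_pos hi]
      exact measurable_sample (p := (i, I.resampleCount l i)) ⟨hi, rfl⟩
    · simp only [f, if_neg hi]
      exact @measurable_const _ _ _ (I.samplesIn S) (ω i)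
  have e : {R | I.current R l ∈ I.event j} = f ⁻¹' I.event j := by
    ext R
    refine I.determinedBy_vblSet (I.event j) _ _ fun i hi => ?_
    have hi' : i ∈ I.vbl j := hi
    simp only [f, if_pos hi']
    rfl
  rw [e]
  exact hf (I.meas j)

/-- Each check in `l` reads samples that are replaced right afterwards. The current samples,
numbered `resampleCount l`, are therefore still unread. -/
theorem measurableSet_consistent' (l : List I.J) :
    MeasurableSet[I.samplesIn {p | p.2 < I.resampleCount l p.1}] {R | I.Consistent R l} := by
  induction l with
  | nil => simp [Consistent]
  | cons j l ih =>
    have e : {R | I.Consistent R (j :: l)} =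
        {R | I.current R l ∈ I.event j} ∩ {R | I.Consistent R l} := rfl
    rw [e]
    refine @MeasurableSet.inter _ (I.samplesIn _) _ _ ?_ ?_
    · refine samplesIn_mono ?_ _ (measurableSet_current_mem l j)
      rintro ⟨i, k⟩ ⟨hi, hk⟩
      simp only at hi hk
      simp [resampleCount_cons, hi, hk]
    · refine samplesIn_mono ?_ _ ih
      rintro ⟨i, k⟩ hk
      simp only [Set.mem_ofPred_eq, resampleCount_cons] at hk ⊢
      omega

theorem measurableSet_consistent (l : List I.J) : MeasurableSet {R | I.Consistent R l} :=
  samplesIn_le _ _ (measurableSet_consistent' l)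

theorem map_current (l : List I.J) :
    I.tableLaw.map (fun R => I.current R l) = Measure.pi I.μ := by
  have h := Measure.map_infinitePi_infinitePi_of_inj (P := fun p : Fin I.n × ℕ => I.μ p.1)
    (f := fun i : Fin I.n => (i, I.resampleCount l i)) (fun i j h => (Prod.ext_iff.1 h).1)
  rw [← Measure.infinitePi_eq_pi]
  exact h

theorem probOf_nonneg (j : I.J) : 0 ≤ I.probOf j := measureReal_nonneg

/-- The check of `j` reads samples numbered exactly `resampleCount l`, the earlier checks only
smaller numbers. Hence the checks are independent, and the current assignment has the product law.
-/
theorem tableLaw_consistent (l : List I.J) :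
    I.tableLaw {R | I.Consistent R l} = ENNReal.ofReal (l.map I.probOf).prod := by
  induction l with
  | nil => simp [Consistent]
  | cons j l ih =>
    have e : {R | I.Consistent R (j :: l)} =
        {R | I.current R l ∈ I.event j} ∩ {R | I.Consistent R l} := rfl
    have hd : Disjoint {p : Fin I.n × ℕ | p.1 ∈ I.vbl j ∧ p.2 = I.resampleCount l p.1}
        {p | p.2 < I.resampleCount l p.1} := by
      rw [Set.disjoint_left]
      rintro p ⟨_, h⟩ h'
      exact absurd h' (by simp [h])
    have hm : Measurable (fun R : I.Table => I.current R l) :=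
      measurable_pi_iff.2 fun i => measurable_pi_apply _
    have hj : I.tableLaw {R | I.current R l ∈ I.event j} = ENNReal.ofReal (I.probOf j) := by
      rw [probOf, ofReal_measureReal, ← map_current l, Measure.map_apply hm (I.meas j)]
      rfl
    rw [e, (ProbabilityTheory.Indep_iff _ _ _).1 (indep_samplesIn hd) _ _
      (measurableSet_current_mem l j) (measurableSet_consistent' l), ih, hj,
      ← ENNReal.ofReal_mul (probOf_nonneg j), List.map_cons, List.prod_cons]

/-! ## Sums over layered histories -/

/-- Factors that are at least `1` may be counted repeatedly. -/
theorem prod_biUnion_le_prod_prod {α β : Type*} [DecidableEq β] (s : Finset α) (t : α → Finset β)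
    (f : β → ℝ) (hf : ∀ b, 1 ≤ f b) : ∏ b ∈ s.biUnion t, f b ≤ ∏ a ∈ s, ∏ b ∈ t a, f b := by
  classical
  have h1 : ∀ r : Finset β, 1 ≤ ∏ b ∈ r, f b := fun r => by
    have h := Finset.prod_le_prod (s := r) (f := fun _ => (1 : ℝ)) (g := f) (by simp)
      (fun b _ => hf b)
    simpa using h
  induction s using Finset.induction_on with
  | empty => simp
  | insert a s ha ih =>
    rw [Finset.biUnion_insert, Finset.prod_insert ha]
    calc ∏ b ∈ t a ∪ s.biUnion t, f b
        ≤ (∏ b ∈ t a ∪ s.biUnion t, f b) * ∏ b ∈ t a ∩ s.biUnion t, f b :=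
          le_mul_of_one_le_right (zero_le_one.trans (h1 _)) (h1 _)
      _ = (∏ b ∈ t a, f b) * ∏ b ∈ s.biUnion t, f b := Finset.prod_union_inter
      _ ≤ _ := mul_le_mul_of_nonneg_left ih (zero_le_one.trans (h1 _))

open Classical in
/-- The sequences of at most `k` layers that may follow the layer `L`. -/
noncomputable def continuations (I : LLLInstance.{u, v}) :
    ℕ → Finset I.J → Finset (List (Finset I.J))
  | 0, _ => {[]}
  | k + 1, L => insert [] (((I.coreDep L).powerset.erase ∅).biUnion fun M =>
      (continuations I k M).image (List.cons M))

theorem mem_continuations {k : ℕ} {L : Finset I.J} {τ : List (Finset I.J)}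
    (h : (L :: τ).IsChain I.Follows) (hk : τ.length ≤ k) : τ ∈ I.continuations k L := by
  induction k generalizing L τ with
  | zero =>
    rw [List.eq_nil_of_length_eq_zero (Nat.le_zero.1 hk)]
    simp [continuations]
  | succ k ih =>
    cases τ with
    | nil => simp [continuations]
    | cons M τ =>
      rw [List.isChain_cons_cons] at h
      simp only [continuations, Finset.mem_insert, reduceCtorEq, Finset.mem_biUnion,
        Finset.mem_erase, Finset.mem_powerset, Finset.mem_image, List.cons.injEq, false_or]
      exact ⟨M, ⟨h.1.1.ne_empty, h.1.2⟩, τ, ih h.2 (by simpa using hk), rfl, rfl⟩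

section Weights

variable (q y : I.J → ℝ)

/-- The product of the weights of the events of a layered history. -/
noncomputable def weight (τ : List (Finset I.J)) : ℝ := ((flat τ).map q).prod

theorem weight_cons (L : Finset I.J) (τ : List (Finset I.J)) :
    weight q (L :: τ) = (∏ a ∈ L, q a) * weight q τ := by
  simp [weight, Finset.prod_map_toList]

variable {q y}

theorem weight_nonneg (hq : ∀ j, 0 ≤ q j) (τ : List (Finset I.J)) : 0 ≤ weight q τ := by
  refine List.prod_nonneg ?_
  simp only [List.mem_map, forall_exists_index, and_imp]
  rintro _ j _ rfl
  exact hq j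

/-- Passes from the condition on single events to whole layers: the dependents of a layer are the
union of the dependents of its members. -/
theorem prod_mul_prod_coreDep_le (hq : ∀ j, 0 ≤ q j) (hy : ∀ j, 0 ≤ y j)
    (h : ∀ b ∈ I.core, q b * ∏ c ∈ I.coreDep {b}, (1 + y c) ≤ y b)
    {L : Finset I.J} (hL : L ⊆ I.core) :
    (∏ a ∈ L, q a) * ∏ c ∈ I.coreDep L, (1 + y c) ≤ ∏ a ∈ L, y a := by
  classical
  have e : I.coreDep L = L.biUnion fun a => I.coreDep {a} := by
    ext b
    simp only [coreDep, Finset.mem_filter, Finset.mem_biUnion, Finset.mem_singleton,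
      exists_eq_left]
    tauto
  calc (∏ a ∈ L, q a) * ∏ c ∈ I.coreDep L, (1 + y c)
      ≤ (∏ a ∈ L, q a) * ∏ a ∈ L, ∏ c ∈ I.coreDep {a}, (1 + y c) := by
        refine mul_le_mul_of_nonneg_left ?_ (Finset.prod_nonneg fun a _ => hq a)
        rw [e]
        exact prod_biUnion_le_prod_prod _ _ _ fun b => by linarith [hy b]
    _ = ∏ a ∈ L, (q a * ∏ c ∈ I.coreDep {a}, (1 + y c)) := Finset.prod_mul_distrib.symm
    _ ≤ ∏ a ∈ L, y a := by
        refine Finset.prod_le_prod (fun a _ => mul_nonneg (hq a) ?_) fun a ha => h a (hL ha)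
        exact Finset.prod_nonneg fun c _ => by linarith [hy c]

/-- By induction, the continuations whose first layer is `M` weigh at most `∏ a ∈ M, y a`. The empty
continuation plays the part of `M = ∅`, and the sum over all subsets `M` of `coreDep L` is the
expansion of the product on the right. -/
theorem sum_continuations_le (hq : ∀ j, 0 ≤ q j) (hy : ∀ j, 0 ≤ y j)
    (h : ∀ b ∈ I.core, q b * ∏ c ∈ I.coreDep {b}, (1 + y c) ≤ y b) (k : ℕ) (L : Finset I.J) :
    ∑ τ ∈ I.continuations k L, weight q τ ≤ ∏ c ∈ I.coreDep L, (1 + y c) := by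
  classical
  have hnil : weight q ([] : List (Finset I.J)) = 1 := by simp [weight]
  induction k generalizing L with
  | zero =>
    simp only [continuations, Finset.sum_singleton, hnil]
    have h := Finset.prod_le_prod (s := I.coreDep L) (f := fun _ => (1 : ℝ))
      (g := fun c => 1 + y c) (by simp) (fun b _ => by linarith [hy b])
    simpa using h
  | succ k ih =>
    rw [continuations, Finset.sum_insert (by simp), hnil, Finset.sum_biUnion, Finset.prod_one_add,
      ← Finset.insert_erase (Finset.empty_mem_powerset (I.coreDep L)), Finset.sum_insert (by simp),
      Finset.prod_empty, Finset.erase_insert_eq_erase, Finset.erase_idem]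
    · gcongr with M hM
      rw [Finset.sum_image (by simp)]
      simp only [weight_cons, ← Finset.mul_sum]
      have hMc : M ⊆ I.core := by
        simp only [Finset.mem_erase, Finset.mem_powerset] at hM
        exact hM.2.trans (Finset.filter_subset _ _)
      exact (mul_le_mul_of_nonneg_left (ih M) (Finset.prod_nonneg fun a _ => hq a)).trans
        (prod_mul_prod_coreDep_le hq hy h hMc)
    · intro M _ M' _ hMM'
      rw [Function.onFun, Finset.disjoint_left]
      simp only [Finset.mem_image]
      rintro _ ⟨τ, _, rfl⟩ ⟨τ', _, e⟩
      exact hMM' (List.cons.inj e).1.symm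

/-- The tails of the layered histories of the event `a`. -/
def tails (I : LLLInstance.{u, v}) (a : I.J) : Set (List (Finset I.J)) :=
  {τ | ({a} :: τ).IsChain I.Follows}

/-- Finitely many tails have bounded length, so every finite partial sum is covered by the bound for
some depth `k`. -/
theorem tsum_tails_le (hq : ∀ j, 0 ≤ q j) (hy : ∀ j, 0 ≤ y j)
    (h : ∀ b ∈ I.core, q b * ∏ c ∈ I.coreDep {b}, (1 + y c) ≤ y b) (a : I.J) :
    ∑' τ : I.tails a, ENNReal.ofReal (weight q ({a} :: τ.1)) ≤
      ENNReal.ofReal (q a * ∏ c ∈ I.coreDep {a}, (1 + y c)) := by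
  classical
  rw [ENNReal.tsum_eq_iSup_sum]
  refine iSup_le fun s => ?_
  rw [← ENNReal.ofReal_sum_of_nonneg fun τ _ => weight_nonneg hq _]
  refine ENNReal.ofReal_le_ofReal ?_
  simp only [weight_cons, Finset.prod_singleton, ← Finset.mul_sum]
  refine mul_le_mul_of_nonneg_left ?_ (hq a)
  refine le_trans ?_ (sum_continuations_le hq hy h (s.sup fun τ => τ.1.length) {a})
  rw [← Finset.sum_image (f := weight q) (g := Subtype.val) (by simp)]
  refine Finset.sum_le_sum_of_subset_of_nonneg ?_ fun τ _ _ => weight_nonneg hq τ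
  intro τ hτ
  obtain ⟨τ, hs, rfl⟩ := Finset.mem_image.1 hτ
  exact mem_continuations τ.2 (Finset.le_sup (f := fun τ : I.tails a => τ.1.length) hs)

end Weights

end LLLInstance

namespace LLLInstance

variable {I : LLLInstance.{u, v}}

/-! ## Resamplings are witnessed by layered histories -/

open Classical in
-- The discarded events are independent of `a`: none of them is `a` or contains a variable of `a`.
-- So the history retains every copy of `a` and every resampling of these variables. The two counts
-- serve the bounds without and with slack.
theorem exists_tail_of_consistent {R : I.Table} {a : I.J} {l : List I.J}
    (h : I.Consistent R (a :: l)) (hl : ∀ j ∈ l, j ∈ I.core) :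
    ∃ τ ∈ I.tails a, I.Consistent R (flat ({a} :: τ)) ∧
      (flat ({a} :: τ)).count a = (a :: l).count a ∧
      ∀ i ∈ I.vbl a, I.resampleCount (a :: l) i ≤ (flat ({a} :: τ)).length := by
  obtain ⟨τ, d, hτ, ht, hd⟩ := exists_history a l hl
  have hc : I.Consistent R (d ++ flat ({a} :: τ)) := by
    have := (ht.2 R []).1 (by simpa using h)
    simpa using this
  refine ⟨τ, hτ, hc.of_append, ?_, fun i hi => ?_⟩
  · rw [ht.1.count_eq, List.count_append,
      List.count_eq_zero_of_not_mem fun ha => hd a ha (dep_refl a), zero_add]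
  · have h0 : I.resampleCount d i = 0 := by
      rw [resampleCount, List.countP_eq_zero]
      intro c hc hic
      exact hd c hc (Or.inr ⟨i, Finset.mem_inter.2 ⟨hi, by simpa using hic⟩⟩)
    rw [resampleCount_perm ht.1]
    unfold resampleCount at h0 ⊢
    rw [List.countP_append, h0, zero_add]
    exact List.countP_le_length

open Classical in
theorem exists_suffix_of_le_count {a : I.J} {l : List I.J} {k : ℕ} (hk : 1 ≤ k)
    (h : k ≤ l.count a) : ∃ m m', l = m' ++ a :: m ∧ (a :: m).count a = k := by
  induction l with
  | nil => simp at h; omega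
  | cons b l ih =>
    by_cases hkl : k ≤ l.count a
    · obtain ⟨m, m', rfl, hm⟩ := ih hkl
      exact ⟨m, b :: m', rfl, hm⟩
    · have hba : b = a := by
        by_contra hba
        rw [List.count_cons_of_ne hba] at h
        exact hkl h
      subst hba
      refine ⟨l, [], rfl, ?_⟩
      rw [List.count_cons_self] at h ⊢
      omega

/-- The number of layered histories of `a` that are consistent with the random source. -/
noncomputable def historyCount (I : LLLInstance.{u, v}) (a : I.J) (R : I.Table) : ℝ≥0∞ :=
  ∑' τ : I.tails a, Set.indicator {R | I.Consistent R (flat ({a} :: τ.1))} (fun _ => 1) R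

open Classical in
theorem count_le_historyCount {R : I.Table} {l : List I.J} (hl : I.IsLog R l) (a : I.J) :
    (l.count a : ℝ≥0∞) ≤ I.historyCount a R := by
  obtain ⟨hR, hcore⟩ := isLog_iff.1 hl
  have key : ∀ k : Fin (l.count a), ∃ τ : I.tails a,
      I.Consistent R (flat ({a} :: τ.1)) ∧ (flat ({a} :: τ.1)).count a = k.1 + 1 := by
    intro k
    -- A suffix of the log is an initial phase of the execution, here the one ending with resampling
    -- number `k + 1` of `a`. The number of copies of `a` makes `f` injective.
    obtain ⟨m, m', rfl, hm⟩ := exists_suffix_of_le_count (k := k.1 + 1) (by omega) k.2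
    obtain ⟨τ, hτ, h₁, h₂, _⟩ := exists_tail_of_consistent hR.of_append
      (fun j hj => hcore j (by simp [hj]))
    exact ⟨⟨τ, hτ⟩, h₁, h₂.trans hm⟩
  choose f hf hf' using key
  have hinj : Function.Injective f := by
    intro k k' hkk
    have := hf' k
    rw [hkk, hf' k'] at this
    exact Fin.ext (by omega)
  calc (l.count a : ℝ≥0∞)
      = ∑' k : Fin (l.count a),
          Set.indicator {R | I.Consistent R (flat ({a} :: (f k).1))} (fun _ => 1) R := by
        rw [tsum_fintype, Finset.sum_congr rfl fun k _ => Set.indicator_of_mem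
          (show R ∈ {R | I.Consistent R (flat ({a} :: (f k).1))} from hf k) _]
        simp
    _ ≤ I.historyCount a R := ENNReal.tsum_comp_le_tsum_of_injective hinj
      (fun τ : I.tails a =>
        Set.indicator {R | I.Consistent R (flat ({a} :: τ.1))} (fun _ => (1 : ℝ≥0∞)) R)

theorem resamplings_le (R : I.Table) :
    (I.resamplings R : ℝ≥0∞) ≤ ∑ a ∈ I.core, I.historyCount a R := by
  classical
  unfold resamplings
  rw [ENat.toENNReal_iSup]
  refine iSup_le fun l => ?_
  have hlen : l.1.length = ∑ a ∈ I.core, l.1.count a := by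
    have := Multiset.sum_count_eq_card (s := I.core) (m := (l.1 : Multiset I.J))
      (by simpa using (isLog_iff.1 l.2).2)
    simpa using this.symm
  have := Finset.sum_le_sum fun a (_ : a ∈ I.core) => count_le_historyCount l.2 a
  rw [← Nat.cast_sum, ← hlen] at this
  simpa using this

theorem measurable_historyCount (a : I.J) : Measurable (I.historyCount a) := by
  have : Countable (I.tails a) := Subtype.countable
  exact Measurable.tsum fun τ => measurable_const.indicator (measurableSet_consistent _)

theorem lintegral_historyCount (a : I.J) :
    ∫⁻ R, I.historyCount a R ∂I.tableLaw =
      ∑' τ : I.tails a, ENNReal.ofReal (weight I.probOf ({a} :: τ.1)) := by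
  have : Countable (I.tails a) := Subtype.countable
  unfold historyCount
  rw [lintegral_tsum fun τ =>
    (measurable_const.indicator (measurableSet_consistent _)).aemeasurable]
  congr 1
  funext τ
  rw [lintegral_indicator_const (measurableSet_consistent _), one_mul, tableLaw_consistent]
  rfl

/-! ## The Local Lemma condition -/

variable {x q : I.J → ℝ}

theorem one_add_div {t : ℝ} (ht : t < 1) : 1 + t / (1 - t) = (1 - t)⁻¹ := by
  have : 1 - t ≠ 0 := by linarith
  field_simp
  ring

theorem mul_prod_coreNbr_le (hx : ∀ j, 0 < x j ∧ x j < 1) {b : I.J}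
    (h : q b ≤ x b * ∏ k ∈ I.coreNbr b, (1 - x k)) :
    q b * ∏ c ∈ I.coreNbr b, (1 + x c / (1 - x c)) ≤ x b := by
  have hpos : 0 < ∏ k ∈ I.coreNbr b, (1 - x k) :=
    Finset.prod_pos fun k _ => by linarith [(hx k).2]
  rw [Finset.prod_congr rfl fun c _ => one_add_div (hx c).2, Finset.prod_inv_distrib,
    ← div_eq_mul_inv]
  exact (div_le_iff₀ hpos).2 h

theorem coreDep_singleton_of_notMem {b : I.J} (hb : b ∉ I.core) :
    I.coreDep {b} = I.coreNbr b := by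
  ext c
  simp only [coreDep, coreNbr, Finset.mem_filter, Finset.mem_singleton, exists_eq_left]
  unfold Dep
  refine and_congr_right fun hc => ?_
  have : c ≠ b := fun h => hb (h ▸ hc)
  tauto

open Classical in
theorem coreDep_singleton_of_mem {b : I.J} (hb : b ∈ I.core) :
    I.coreDep {b} = insert b (I.coreNbr b) := by
  ext c
  simp only [coreDep, coreNbr, Finset.mem_filter, Finset.mem_singleton, exists_eq_left,
    Finset.mem_insert]
  unfold Dep
  by_cases h : c = b
  · subst h; tauto
  · tauto

/-- A core event depends on itself, which costs the additional factor `1 / (1 - x b)`. -/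
theorem mul_prod_coreDep_le (hx : ∀ j, 0 < x j ∧ x j < 1) {b : I.J} (hb : b ∈ I.core)
    (h : q b ≤ x b * ∏ k ∈ I.coreNbr b, (1 - x k)) :
    q b * ∏ c ∈ I.coreDep {b}, (1 + x c / (1 - x c)) ≤ x b / (1 - x b) := by
  classical
  have h1 : 0 < 1 - x b := by linarith [(hx b).2]
  rw [coreDep_singleton_of_mem hb, Finset.prod_insert (by simp [coreNbr]), one_add_div (hx b).2,
    mul_left_comm, ← div_eq_inv_mul]
  exact (div_le_div_iff_of_pos_right h1).2 (mul_prod_coreNbr_le hx h)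

theorem prod_one_sub_le_one (hx : ∀ j, 0 < x j ∧ x j < 1) (s : Finset I.J) :
    ∏ k ∈ s, (1 - x k) ≤ 1 :=
  Finset.prod_le_one (fun k _ => by linarith [(hx k).2]) fun k _ => by linarith [(hx k).1]

theorem prod_one_sub_pos (hx : ∀ j, 0 < x j ∧ x j < 1) (s : Finset I.J) :
    0 < ∏ k ∈ s, (1 - x k) :=
  Finset.prod_pos fun k _ => by linarith [(hx k).2]

theorem lintegral_resamplings_le_sum (hx : ∀ j, 0 < x j ∧ x j < 1)
    (h : ∀ j ∈ I.core, I.probOf j ≤ x j * ∏ k ∈ I.coreNbr j, (1 - x k)) :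
    ∫⁻ R, ∑ a ∈ I.core, I.historyCount a R ∂I.tableLaw ≤
      ENNReal.ofReal (∑ j ∈ I.core, x j / (1 - x j)) := by
  have hy : ∀ j, 0 ≤ x j / (1 - x j) := fun j =>
    div_nonneg (hx j).1.le (by linarith [(hx j).2])
  rw [lintegral_finsetSum _ fun a _ => measurable_historyCount a,
    ENNReal.ofReal_sum_of_nonneg fun j _ => hy j]
  refine Finset.sum_le_sum fun a ha => ?_
  rw [lintegral_historyCount]
  refine (tsum_tails_le probOf_nonneg hy (fun b hb => mul_prod_coreDep_le hx hb (h b hb)) a).trans ?_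
  exact ENNReal.ofReal_le_ofReal (mul_prod_coreDep_le hx ha (h a ha))

theorem sum_div_one_sub_le (hx : ∀ j, 0 < x j ∧ x j < 1) :
    ∑ j ∈ I.core, x j / (1 - x j) ≤ I.v₁ x := by
  unfold v₁ T
  rw [Finset.sum_mul]
  refine Finset.sum_le_sum fun j hj => ?_
  rw [div_eq_mul_one_div]
  refine mul_le_mul_of_nonneg_left ?_ (hx j).1.le
  exact le_ciSup (f := fun j : I.core => 1 / (1 - x j)) (Set.finite_range _).bddAbove ⟨j, hj⟩

/-! ## Termination and the output -/

theorem tableLaw_resamplings_eq_top (hx : ∀ j, 0 < x j ∧ x j < 1)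
    (h : ∀ j ∈ I.core, I.probOf j ≤ x j * ∏ k ∈ I.coreNbr j, (1 - x k)) :
    I.tableLaw {R | I.resamplings R = ⊤} = 0 := by
  have hm : Measurable fun R => ∑ a ∈ I.core, I.historyCount a R :=
    Finset.measurable_fun_sum _ fun a _ => measurable_historyCount a
  have hfin := ae_lt_top hm
    ((lintegral_resamplings_le_sum hx h).trans_lt ENNReal.ofReal_lt_top).ne
  refine measure_mono_null ?_ (ae_iff.1 hfin)
  intro R hR hlt
  have hR' : I.resamplings R = ⊤ := hR
  have := resamplings_le R
  rw [hR'] at this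
  exact absurd hlt (by simpa using this)

/-- If `a` ever holds, then `a :: l` is consistent although `a` is never resampled, so a history of
`a` exists. Its lower layers avoid `a`, hence the bound `x a` rather than `x a / (1 - x a)`. -/
theorem tableLaw_exists_isLog_holds_le (hx : ∀ j, 0 < x j ∧ x j < 1)
    (h : ∀ j, I.probOf j ≤ x j * ∏ k ∈ I.coreNbr j, (1 - x k)) {a : I.J} (ha : a ∉ I.core) :
    I.tableLaw {R | ∃ l, I.IsLog R l ∧ I.current R l ∈ I.event a} ≤ ENNReal.ofReal (x a) := by
  have hy : ∀ j, 0 ≤ x j / (1 - x j) := fun j =>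
    div_nonneg (hx j).1.le (by linarith [(hx j).2])
  have : Countable (I.tails a) := Subtype.countable
  calc I.tableLaw {R | ∃ l, I.IsLog R l ∧ I.current R l ∈ I.event a}
      ≤ I.tableLaw (⋃ τ : I.tails a, {R | I.Consistent R (flat ({a} :: τ.1))}) := by
        refine measure_mono ?_
        rintro R ⟨l, hl, hR⟩
        obtain ⟨hc, hcore⟩ := isLog_iff.1 hl
        obtain ⟨τ, hτ, h₁, _⟩ := exists_tail_of_consistent (a := a) (l := l) ⟨hR, hc⟩ hcore
        exact Set.mem_iUnion.2 ⟨⟨τ, hτ⟩, h₁⟩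
    _ ≤ ∑' τ : I.tails a, I.tableLaw {R | I.Consistent R (flat ({a} :: τ.1))} :=
        measure_iUnion_le _
    _ = ∑' τ : I.tails a, ENNReal.ofReal (weight I.probOf ({a} :: τ.1)) := by
        simp only [tableLaw_consistent]; rfl
    _ ≤ _ := tsum_tails_le probOf_nonneg hy (fun b hb => mul_prod_coreDep_le hx hb (h b)) a
    _ ≤ _ := by
        rw [coreDep_singleton_of_notMem ha]
        exact ENNReal.ofReal_le_ofReal (mul_prod_coreNbr_le hx (h a))

theorem one_sub_sum_le_tableLaw_successSet (hx : ∀ j, 0 < x j ∧ x j < 1)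
    (h : ∀ j, I.probOf j ≤ x j * ∏ k ∈ I.coreNbr j, (1 - x k)) :
    1 - ∑ j ∈ I.nonCore, x j ≤ I.tableLaw.real I.successSet := by
  classical
  -- Covering the whole space needs only subadditivity of the outer measure, so measurability of
  -- `successSet` is not an issue.
  have hsub : Set.univ ⊆ I.successSet ∪ ({R | I.resamplings R = ⊤} ∪
      ⋃ a ∈ I.nonCore, {R | ∃ l, I.IsLog R l ∧ I.current R l ∈ I.event a}) := by
    intro R _
    by_cases hR : I.resamplings R = ⊤
    · exact Or.inr (Or.inl hR)
    by_cases hl : ∃ a ∈ I.nonCore, ∃ l, I.IsLog R l ∧ I.current R l ∈ I.event a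
    · right; right
      simpa using hl
    · left
      refine ⟨lt_top_iff_ne_top.2 hR, fun l hf j hj => ?_⟩
      by_cases hjc : j ∈ I.core
      · exact hf.2 j hjc hj
      · exact hl ⟨j, by simp [nonCore, hjc], l, hf.1, hj⟩
  have h1 : (1 : ℝ≥0∞) ≤ I.tableLaw I.successSet + ENNReal.ofReal (∑ j ∈ I.nonCore, x j) := by
    calc (1 : ℝ≥0∞) = I.tableLaw Set.univ := measure_univ.symm
      _ ≤ _ := measure_mono hsub
      _ ≤ _ := measure_union_le _ _
      _ ≤ I.tableLaw I.successSet + (0 + ∑ a ∈ I.nonCore, ENNReal.ofReal (x a)) := by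
        gcongr
        refine (measure_union_le _ _).trans ?_
        rw [tableLaw_resamplings_eq_top hx fun j _ => h j]
        gcongr
        refine (measure_biUnion_finset_le _ _).trans (Finset.sum_le_sum fun a ha => ?_)
        exact tableLaw_exists_isLog_holds_le hx h (by simpa [nonCore] using ha)
      _ = _ := by rw [zero_add, ENNReal.ofReal_sum_of_nonneg fun j _ => (hx j).1.le]
  have h2 := ENNReal.toReal_mono (by finiteness) h1
  rw [ENNReal.toReal_add (by finiteness) (by finiteness), ENNReal.toReal_ofReal
    (Finset.sum_nonneg fun j _ => (hx j).1.le), ENNReal.toReal_one] at h2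
  unfold Measure.real
  linarith

end LLLInstance

/-! ### From tail bounds to probabilities and expectations -/

section Tails

variable {α : Type*} [MeasurableSpace α] {μ : Measure α} [IsProbabilityMeasure μ]

theorem one_sub_le_measureReal {s : Set α} {b : ℝ} (hb : 0 ≤ b)
    (h : μ sᶜ ≤ ENNReal.ofReal b) : 1 - b ≤ μ.real s := by
  have h1 : (1 : ℝ≥0∞) ≤ μ s + ENNReal.ofReal b := by
    calc (1 : ℝ≥0∞) = μ (s ∪ sᶜ) := by rw [Set.union_compl_self, measure_univ]
      _ ≤ μ s + μ sᶜ := measure_union_le _ _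
      _ ≤ _ := by gcongr
  have h2 := ENNReal.toReal_mono (by finiteness) h1
  rw [ENNReal.toReal_add (by finiteness) (by finiteness), ENNReal.toReal_ofReal hb,
    ENNReal.toReal_one] at h2
  unfold Measure.real
  linarith

theorem le_mul_one_add_tsum_indicator {M : ℝ} (hM : 0 < M) (t : ℝ≥0∞) :
    t ≤ ENNReal.ofReal M *
      (1 + ∑' k : ℕ, if ENNReal.ofReal ((k + 1) * M) < t then 1 else 0) := by
  classical
  by_cases h : ∃ K : ℕ, t ≤ ENNReal.ofReal ((K + 1) * M)
  · have hK := Nat.find_spec h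
    set K := Nat.find h with hKdef
    have hlt : ∀ k < K, ENNReal.ofReal ((k + 1) * M) < t := fun k hk =>
      not_le.1 (Nat.find_min h hk)
    have hsum : (K : ℝ≥0∞) ≤
        ∑' k : ℕ, if ENNReal.ofReal ((k + 1) * M) < t then (1 : ℝ≥0∞) else 0 := by
      refine le_trans ?_ (ENNReal.sum_le_tsum (Finset.range K))
      rw [Finset.sum_congr rfl fun k hk => if_pos (hlt k (Finset.mem_range.1 hk))]
      simp
    calc t ≤ ENNReal.ofReal ((K + 1) * M) := hK
      _ = ENNReal.ofReal M * (1 + K) := by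
        rw [mul_comm, ENNReal.ofReal_mul hM.le, add_comm (K : ℝ), ENNReal.ofReal_add zero_le_one
          (Nat.cast_nonneg _), ENNReal.ofReal_one, ENNReal.ofReal_natCast]
      _ ≤ _ := by gcongr
  · push Not at h
    have htop : ∑' k : ℕ, (if ENNReal.ofReal ((k + 1) * M) < t then (1 : ℝ≥0∞) else 0) = ⊤ := by
      rw [tsum_congr fun k => if_pos (h k)]
      exact ENNReal.tsum_const_eq_top_of_ne_zero one_ne_zero
    rw [htop, add_top, ENNReal.mul_top (by simpa using hM)]
    exact le_top

/-- Cut the range of `f` into steps of height `M`. As `exp (-1) ≤ 1 / 2`, the tails at `M, 2 * M, …`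
sum to at most `1`, and the first step contributes one more `M`. -/
theorem lintegral_le_of_exp_tail {f : α → ℝ≥0∞} {M : ℝ} (hM : 0 ≤ M)
    (h : ∀ r : ℝ, 1 ≤ r → μ {a | ENNReal.ofReal (r * M) < f a} ≤ ENNReal.ofReal (Real.exp (-r))) :
    ∫⁻ a, f a ∂μ ≤ ENNReal.ofReal (2 * M) := by
  rcases hM.eq_or_lt with rfl | hM
  · have h0 : μ {a | f a ≠ 0} = 0 := by
      have ht : Filter.Tendsto (fun r : ℝ => ENNReal.ofReal (Real.exp (-r))) Filter.atTop
          (nhds 0) := by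
        rw [← ENNReal.ofReal_zero]
        exact (ENNReal.continuous_ofReal.tendsto 0).comp
          (Real.tendsto_exp_atBot.comp Filter.tendsto_neg_atTop_atBot)
      refine le_antisymm (ge_of_tendsto ht ?_) bot_le
      filter_upwards [Filter.eventually_ge_atTop 1] with r hr
      have := h r hr
      simpa [pos_iff_ne_zero] using this
    have h1 : f =ᵐ[μ] fun _ => 0 := ae_iff.2 h0
    rw [lintegral_congr_ae h1]
    simp
  -- Since `f` need not be measurable, its superlevel sets are replaced by measurable hulls.
  let B : ℕ → Set α := fun k => toMeasurable μ {a | ENNReal.ofReal ((k + 1) * M) < f a}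
  have hB : ∀ k, MeasurableSet (B k) := fun k => measurableSet_toMeasurable _ _
  have hμ : ∀ k, μ (B k) ≤ 2⁻¹ ^ (k + 1) := by
    intro k
    rw [measure_toMeasurable]
    refine (h (k + 1) (by linarith [(Nat.cast_nonneg k : (0 : ℝ) ≤ k)])).trans ?_
    have h2 : Real.exp (-1) ≤ 2⁻¹ := by
      rw [Real.exp_neg]
      exact inv_anti₀ two_pos (by linarith [Real.add_one_le_exp 1])
    have h3 : Real.exp (-((k : ℝ) + 1)) ≤ 2⁻¹ ^ (k + 1) := by
      have e : -((k : ℝ) + 1) = ((k + 1 : ℕ) : ℝ) * (-1) := by push_cast; ring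
      rw [e, Real.exp_nat_mul]
      exact pow_le_pow_left₀ (Real.exp_pos _).le h2 _
    refine (ENNReal.ofReal_le_ofReal h3).trans_eq ?_
    rw [ENNReal.ofReal_pow (by norm_num), ENNReal.ofReal_inv_of_pos two_pos]
    norm_num
  calc ∫⁻ a, f a ∂μ
      ≤ ∫⁻ a, ENNReal.ofReal M * (1 + ∑' k : ℕ, (B k).indicator (fun _ => 1) a) ∂μ := by
        refine lintegral_mono fun a => (le_mul_one_add_tsum_indicator hM (f a)).trans ?_
        gcongr with k
        split_ifs with hk
        · rw [Set.indicator_of_mem]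
          exact subset_toMeasurable _ _ hk
        · exact bot_le
    _ = ENNReal.ofReal M * (1 + ∑' k : ℕ, μ (B k)) := by
        have hm : ∀ k, Measurable ((B k).indicator fun _ => (1 : ℝ≥0∞)) := fun k =>
          measurable_const.indicator (hB k)
        rw [lintegral_const_mul _ (by fun_prop),
          lintegral_add_left measurable_const, lintegral_tsum fun k => (hm k).aemeasurable]
        simp [lintegral_indicator_const (hB _)]
    _ ≤ ENNReal.ofReal M * (1 + ∑' k : ℕ, 2⁻¹ ^ (k + 1)) := by
        gcongr with k
        exact hμ k
    _ = ENNReal.ofReal (2 * M) := by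
        have e : ∑' k : ℕ, (2⁻¹ : ℝ≥0∞) ^ (k + 1) = 1 := by
          rw [ENNReal.tsum_geometric_add_one, ENNReal.one_sub_inv_two, inv_inv,
            ENNReal.inv_mul_cancel two_ne_zero ENNReal.ofNat_ne_top]
        rw [e, ENNReal.ofReal_mul zero_le_two, mul_comm, one_add_one_eq_two]
        simp

end Tails

namespace LLLInstance

variable {I : LLLInstance.{u, v}} {x : I.J → ℝ}

/-! ## The sum of `x` over the core -/

theorem one_sub_le_two_rpow_neg {t : ℝ} (ht : 0 ≤ t) : 1 - t ≤ (2 : ℝ) ^ (-t) := by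
  rw [Real.rpow_def_of_pos two_pos]
  refine (Real.one_sub_le_exp_neg t).trans (Real.exp_le_exp.2 ?_)
  nlinarith [Real.log_two_lt_d9]

/-- The left side is at most `b * (1 - b) ≤ 1 / 4` when `b ≥ 0`, and the exponent exceeds `-2`. This
handles the factor `x a`, to which `1 - t ≤ 2 ^ (-t)` does not apply, by pairing it with one
neighbour. -/
theorem mul_one_sub_le_two_rpow_neg {a b : ℝ} (hab : a ≤ b) (hb : b < 1) :
    a * (1 - b) ≤ (2 : ℝ) ^ (-(a + b)) := by
  calc a * (1 - b) ≤ 1 / 4 := by nlinarith [sq_nonneg (b - 1 / 2)]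
    _ = (2 : ℝ) ^ (-2 : ℝ) := by
      rw [Real.rpow_neg two_pos.le]; norm_num
    _ ≤ _ := Real.rpow_le_rpow_of_exponent_le one_le_two (by linarith)

theorem δ_le {j : I.J} (hx : ∀ j, 0 < x j ∧ x j < 1) (hj : j ∈ I.core) :
    0 < I.δ x ∧ I.δ x ≤ x j * ∏ k ∈ I.coreNbr j, (1 - x k) := by
  have : Nonempty I.core := ⟨⟨j, hj⟩⟩
  constructor
  · obtain ⟨i, hi⟩ := exists_eq_ciInf_of_finite
      (f := fun j : I.core => x j * ∏ k ∈ I.coreNbr j, (1 - x k))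
    unfold δ
    rw [← hi]
    exact mul_pos (hx _).1 (prod_one_sub_pos hx _)
  · exact ciInf_le (Set.finite_range
      (fun j : I.core => x j * ∏ k ∈ I.coreNbr j, (1 - x k))).bddBelow ⟨j, hj⟩

open Classical in
-- The events containing `i` are pairwise neighbours. If there are at least two, the one with least
-- `x` shows that `δ` is at most `2` to the power minus the sum; a single event has `x < 1`.
theorem sum_filter_mem_vbl_le (hx : ∀ j, 0 < x j ∧ x j < 1) (i : Fin I.n) :
    ∑ j ∈ I.core with i ∈ I.vbl j, x j ≤ max 1 (Real.logb 2 (1 / I.δ x)) := by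
  set K := I.core.filter fun j => i ∈ I.vbl j with hK
  rcases K.eq_empty_or_nonempty with h0 | hne
  · rw [h0, Finset.sum_empty]
    exact le_max_of_le_left zero_le_one
  obtain ⟨a, ha, hmin⟩ := Finset.exists_min_image K x hne
  rcases (K.erase a).eq_empty_or_nonempty with h1 | ⟨b, hb⟩
  · rw [← Finset.add_sum_erase K x ha, h1, Finset.sum_empty, add_zero]
    exact le_max_of_le_left (hx a).2.le
  refine le_max_of_le_right ?_
  have hbK := (Finset.mem_erase.1 hb).2
  have hac : a ∈ I.core := (Finset.mem_filter.1 ha).1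
  obtain ⟨hδ, hδa⟩ := δ_le hx hac
  have hsub : K.erase a ⊆ I.coreNbr a := by
    intro c hc
    rw [Finset.mem_erase, hK, Finset.mem_filter] at hc
    exact Finset.mem_filter.2 ⟨hc.2.1, hc.1, i,
      Finset.mem_inter.2 ⟨hc.2.2, (Finset.mem_filter.1 ha).2⟩⟩
  have hprod : ∏ k ∈ I.coreNbr a, (1 - x k) ≤ ∏ k ∈ K.erase a, (1 - x k) := by
    rw [← Finset.prod_sdiff hsub]
    exact mul_le_of_le_one_left (prod_one_sub_pos hx _).le (prod_one_sub_le_one hx _)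
  have hrest : ∏ k ∈ (K.erase a).erase b, (1 - x k) ≤
      (2 : ℝ) ^ (-∑ k ∈ (K.erase a).erase b, x k) := by
    rw [← Finset.sum_neg_distrib, Real.rpow_sum_of_pos two_pos]
    exact Finset.prod_le_prod (fun k _ => by linarith [(hx k).2])
      fun k _ => one_sub_le_two_rpow_neg (hx k).1.le
  have hδ2 : I.δ x ≤ (2 : ℝ) ^ (-∑ k ∈ K, x k) := by
    calc I.δ x ≤ x a * ∏ k ∈ K.erase a, (1 - x k) :=
          hδa.trans (mul_le_mul_of_nonneg_left hprod (hx a).1.le)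
      _ = (x a * (1 - x b)) * ∏ k ∈ (K.erase a).erase b, (1 - x k) := by
          rw [← Finset.mul_prod_erase (K.erase a) _ hb, mul_assoc]
      _ ≤ (2 : ℝ) ^ (-(x a + x b)) * (2 : ℝ) ^ (-∑ k ∈ (K.erase a).erase b, x k) :=
          mul_le_mul (mul_one_sub_le_two_rpow_neg (hmin b hbK) (hx b).2) hrest
            (prod_one_sub_pos hx _).le (by positivity)
      _ = (2 : ℝ) ^ (-∑ k ∈ K, x k) := by
          rw [← Real.rpow_add two_pos, ← Finset.add_sum_erase K x ha,
            ← Finset.add_sum_erase (K.erase a) x hb]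
          ring_nf
  rw [Real.le_logb_iff_rpow_le one_lt_two (by positivity), le_div_iff₀ hδ]
  calc (2 : ℝ) ^ (∑ k ∈ K, x k) * I.δ x
      ≤ (2 : ℝ) ^ (∑ k ∈ K, x k) * (2 : ℝ) ^ (-∑ k ∈ K, x k) := by gcongr
    _ = 1 := by rw [← Real.rpow_add two_pos, add_neg_cancel, Real.rpow_zero]

theorem T_le (hx : ∀ j, 0 < x j ∧ x j < 1) (hne : ∀ j ∈ I.core, (I.vbl j).Nonempty) :
    I.T x ≤ I.n * max 1 (Real.logb 2 (1 / I.δ x)) := by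
  classical
  calc I.T x ≤ ∑ j ∈ I.core, ∑ i, if i ∈ I.vbl j then x j else 0 := by
        refine Finset.sum_le_sum fun j hj => ?_
        obtain ⟨i, hi⟩ := hne j hj
        refine le_trans (by rw [if_pos hi]) (Finset.single_le_sum (fun k _ => ?_)
          (Finset.mem_univ i))
        split_ifs
        exacts [(hx j).1.le, le_rfl]
    _ = ∑ i, ∑ j ∈ I.core with i ∈ I.vbl j, x j := by
        simp only [Finset.sum_filter]
        exact Finset.sum_comm
    _ ≤ ∑ _i : Fin I.n, max 1 (Real.logb 2 (1 / I.δ x)) :=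
        Finset.sum_le_sum fun i _ => sum_filter_mem_vbl_le hx i
    _ = _ := by simp

/-! ## The number of resamplings without slack -/

theorem v₁_nonneg (hx : ∀ j, 0 < x j ∧ x j < 1) : 0 ≤ I.v₁ x :=
  (Finset.sum_nonneg fun j _ => div_nonneg (hx j).1.le (by linarith [(hx j).2])).trans
    (sum_div_one_sub_le hx)

theorem lintegral_resamplings_le_v₁ (hx : ∀ j, 0 < x j ∧ x j < 1)
    (h : ∀ j ∈ I.core, I.probOf j ≤ x j * ∏ k ∈ I.coreNbr j, (1 - x k)) :
    ∫⁻ R, (I.resamplings R : ℝ≥0∞) ∂I.tableLaw ≤ ENNReal.ofReal (I.v₁ x) :=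
  ((lintegral_mono resamplings_le).trans (lintegral_resamplings_le_sum hx h)).trans
    (ENNReal.ofReal_le_ofReal (sum_div_one_sub_le hx))

theorem one_sub_inv_le_tableLaw (hx : ∀ j, 0 < x j ∧ x j < 1)
    (h : ∀ j ∈ I.core, I.probOf j ≤ x j * ∏ k ∈ I.coreNbr j, (1 - x k)) {r : ℝ} (hr : 1 ≤ r) :
    1 - 1 / r ≤ I.tableLaw.real
      {R | (I.resamplings R : ℝ≥0∞) ≤ ENNReal.ofReal (r * I.v₁ x)} := by
  have hr0 : 0 < r := by linarith
  refine one_sub_le_measureReal (by positivity) ?_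
  -- Markov's inequality is applied to this measurable majorant of `resamplings`.
  let G : I.Table → ℝ≥0∞ := fun R => ∑ a ∈ I.core, I.historyCount a R
  have hm : Measurable G := Finset.measurable_fun_sum _ fun a _ => measurable_historyCount a
  have hG : ∫⁻ R, G R ∂I.tableLaw ≤ ENNReal.ofReal (I.v₁ x) :=
    (lintegral_resamplings_le_sum hx h).trans (ENNReal.ofReal_le_ofReal (sum_div_one_sub_le hx))
  have hsub : {R | (I.resamplings R : ℝ≥0∞) ≤ ENNReal.ofReal (r * I.v₁ x)}ᶜ ⊆
      {R | ENNReal.ofReal (r * I.v₁ x) < G R} := by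
    intro R hR
    rw [Set.mem_compl_iff, Set.mem_ofPred_eq, not_le] at hR
    exact hR.trans_le (resamplings_le R)
  refine (measure_mono hsub).trans ?_
  rcases (v₁_nonneg (I := I) hx).eq_or_lt with h0 | h0
  · rw [← h0, ENNReal.ofReal_zero] at hG
    have h1 := (lintegral_eq_zero_iff hm).1 (le_antisymm hG bot_le)
    have h2 : I.tableLaw {R | G R ≠ 0} = 0 := ae_iff.1 h1
    rw [← h0, mul_zero, ENNReal.ofReal_zero]
    simp only [pos_iff_ne_zero]
    rw [h2]
    exact bot_le
  · have hpos : 0 < r * I.v₁ x := mul_pos hr0 h0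
    calc I.tableLaw {R | ENNReal.ofReal (r * I.v₁ x) < G R}
        ≤ I.tableLaw {R | ENNReal.ofReal (r * I.v₁ x) ≤ G R} :=
          measure_mono (Set.ofPred_subset_ofPred.2 fun _ => le_of_lt)
      _ ≤ (∫⁻ R, G R ∂I.tableLaw) / ENNReal.ofReal (r * I.v₁ x) :=
          meas_ge_le_lintegral_div hm.aemeasurable (by simpa using hpos) ENNReal.ofReal_ne_top
      _ ≤ ENNReal.ofReal (I.v₁ x) / ENNReal.ofReal (r * I.v₁ x) := by gcongr
      _ = ENNReal.ofReal (1 / r) := by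
          rw [← ENNReal.ofReal_div_of_pos hpos]
          congr 1
          field_simp

/-! ## The number of resamplings with slack -/

/-- An event determined by no variables is empty or certain. Thus, in the case with slack, every
resampling touches a variable even though `vbl` is not assumed nonempty. -/
theorem vbl_nonempty {j : I.J} {ω : I.Assignment} (hω : ω ∈ I.event j) (hj : I.probOf j < 1) :
    (I.vbl j).Nonempty := by
  by_contra hne
  rw [Finset.not_nonempty_iff_eq_empty] at hne
  have : I.event j = Set.univ := Set.eq_univ_of_forall fun ω' =>
    (I.determinedBy_vblSet (I.event j) ω ω' fun i hi => by
      change i ∈ I.vbl j at hi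
      simp [hne] at hi).1 hω
  simp [probOf, this] at hj

theorem length_le_sum_resampleCount {R : I.Table} {l : List I.J} (hl : I.IsLog R l)
    (hp : ∀ j, I.probOf j < 1) : l.length ≤ ∑ i, I.resampleCount l i := by
  induction hl with
  | nil => simp
  | cons l j _ _ holds ih =>
    simp only [resampleCount_cons, Finset.sum_add_distrib, List.length_cons]
    have : 1 ≤ ∑ i, if i ∈ I.vbl j then 1 else 0 := by
      obtain ⟨i, hi⟩ := vbl_nonempty holds (hp j)
      simpa using ⟨i, hi⟩
    omega

theorem exists_suffix_mem_vbl {i : Fin I.n} {l : List I.J} (h : 0 < I.resampleCount l i) :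
    ∃ a m m', l = m' ++ a :: m ∧ i ∈ I.vbl a ∧
      I.resampleCount (a :: m) i = I.resampleCount l i := by
  induction l with
  | nil => simp [resampleCount] at h
  | cons b l ih =>
    by_cases hb : i ∈ I.vbl b
    · exact ⟨b, l, [], rfl, hb, rfl⟩
    · have e := resampleCount_cons b l i
      rw [if_neg hb, add_zero] at e
      obtain ⟨a, m, m', rfl, ha, hc⟩ := ih (e ▸ h)
      exact ⟨a, m, b :: m', rfl, ha, hc.trans e.symm⟩

theorem weight_const_mul (c : ℝ) (q : I.J → ℝ) (τ : List (Finset I.J)) :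
    weight (fun j => c * q j) τ = c ^ (flat τ).length * weight q τ := by
  unfold weight
  induction flat τ with
  | nil => simp
  | cons a l ih => rw [List.map_cons, List.prod_cons, ih]; simp [pow_succ]; ring

/-- The last event that resamples `i` has a history containing all the resamplings of `i`, hence at
least `s` events. Dividing every probability by `1 - η` preserves the condition without slack and
extracts `(1 - η) ^ s` from each such history. -/
theorem tableLaw_exists_le_resampleCount_le (hx : ∀ j, 0 < x j ∧ x j < 1) {η : ℝ} (hη : 0 ≤ η)
    (hη1 : η < 1)
    (h : ∀ j ∈ I.core, I.probOf j ≤ (1 - η) * x j * ∏ k ∈ I.coreNbr j, (1 - x k)) {s : ℕ}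
    (hs : 0 < s) :
    I.tableLaw {R | ∃ l, I.IsLog R l ∧ ∃ i, s ≤ I.resampleCount l i} ≤
      ENNReal.ofReal ((1 - η) ^ s * ∑ j ∈ I.core, x j / (1 - x j)) := by
  have hη' : 0 < 1 - η := by linarith
  let q : I.J → ℝ := fun j => I.probOf j / (1 - η)
  have hq : ∀ j, 0 ≤ q j := fun j => div_nonneg (probOf_nonneg j) hη'.le
  have hpq : I.probOf = fun j => (1 - η) * q j := by
    funext j
    simp only [q]
    field_simp
  have hqx : ∀ j ∈ I.core, q j ≤ x j * ∏ k ∈ I.coreNbr j, (1 - x k) := fun j hj => by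
    rw [div_le_iff₀ hη']
    linarith [h j hj]
  have hy : ∀ j, 0 ≤ x j / (1 - x j) := fun j =>
    div_nonneg (hx j).1.le (by linarith [(hx j).2])
  have : ∀ a, Countable (I.tails a) := fun a => Subtype.countable
  calc I.tableLaw {R | ∃ l, I.IsLog R l ∧ ∃ i, s ≤ I.resampleCount l i}
      ≤ I.tableLaw (⋃ a ∈ I.core, ⋃ τ : I.tails a,
          {R | I.Consistent R (flat ({a} :: τ.1)) ∧ s ≤ (flat ({a} :: τ.1)).length}) := by
        refine measure_mono ?_
        rintro R ⟨l, hl, i, hi⟩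
        obtain ⟨hc, hcore⟩ := isLog_iff.1 hl
        obtain ⟨a, m, m', rfl, ha, hm⟩ := exists_suffix_mem_vbl (hs.trans_le hi)
        obtain ⟨τ, hτ, h₁, _, h₂⟩ := exists_tail_of_consistent hc.of_append
          fun j hj => hcore j (by simp [hj])
        refine Set.mem_biUnion (hcore a (by simp) : a ∈ I.core) (Set.mem_iUnion.2 ⟨⟨τ, hτ⟩, h₁, ?_⟩)
        exact hi.trans (hm ▸ h₂ i ha)
    _ ≤ ∑ a ∈ I.core, ∑' τ : I.tails a, I.tableLaw
          {R | I.Consistent R (flat ({a} :: τ.1)) ∧ s ≤ (flat ({a} :: τ.1)).length} :=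
        (measure_biUnion_finset_le _ _).trans
          (Finset.sum_le_sum fun a _ => measure_iUnion_le _)
    _ ≤ ∑ a ∈ I.core, ∑' τ : I.tails a,
          ENNReal.ofReal ((1 - η) ^ s) * ENNReal.ofReal (weight q ({a} :: τ.1)) := by
        gcongr with a _ τ
        by_cases hτ : s ≤ (flat ({a} :: τ.1)).length
        · simp only [hτ, and_true]
          rw [tableLaw_consistent, ← ENNReal.ofReal_mul (pow_nonneg hη'.le _)]
          refine ENNReal.ofReal_le_ofReal ?_
          change weight I.probOf ({a} :: τ.1) ≤ _
          rw [hpq, weight_const_mul]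
          exact mul_le_mul_of_nonneg_right
            (pow_le_pow_of_le_one hη'.le (by linarith) hτ) (weight_nonneg hq _)
        · simp only [hτ, and_false]
          simp
    _ ≤ ∑ a ∈ I.core, ENNReal.ofReal ((1 - η) ^ s) * ENNReal.ofReal (x a / (1 - x a)) := by
        simp only [ENNReal.tsum_mul_left]
        gcongr with a ha
        refine (tsum_tails_le hq hy (fun b hb => mul_prod_coreDep_le hx hb (hqx b hb)) a).trans ?_
        exact ENNReal.ofReal_le_ofReal (mul_prod_coreDep_le hx ha (hqx a ha))
    _ = _ := by
        rw [← Finset.mul_sum, ← ENNReal.ofReal_sum_of_nonneg fun j _ => hy j,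
          ← ENNReal.ofReal_mul (pow_nonneg hη'.le _)]

theorem probOf_lt_one (hx : ∀ j, 0 < x j ∧ x j < 1) {ε : ℝ} (hε : 0 ≤ ε)
    (h : ∀ j, I.probOf j ≤ (1 - ε) * x j * ∏ k ∈ I.coreNbr j, (1 - x k)) (j : I.J) :
    I.probOf j < 1 := by
  refine (h j).trans_lt ?_
  have h1 := prod_one_sub_le_one hx (I.coreNbr j)
  have h2 := prod_one_sub_pos hx (I.coreNbr j)
  have h3 := hx j
  calc (1 - ε) * x j * ∏ k ∈ I.coreNbr j, (1 - x k)
      ≤ x j * 1 := mul_le_mul (by nlinarith) h1 h2.le h3.1.le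
    _ < 1 := by linarith

theorem T_nonneg (hx : ∀ j, 0 < x j ∧ x j < 1) : 0 ≤ I.T x :=
  Finset.sum_nonneg fun j _ => (hx j).1.le

theorem v₂_nonneg (hx : ∀ j, 0 < x j ∧ x j < 1) {ε : ℝ} (hε : 0 < ε) : 0 ≤ I.v₂ x ε := by
  have : 0 ≤ I.T x / ε := div_nonneg (T_nonneg hx) hε.le
  exact mul_nonneg (by positivity) (Real.logb_nonneg one_lt_two (by linarith))

/-- Scaling `x` by `1 - ε / 2` spends half of the slack on keeping `x` away from `1`. -/
theorem tableLaw_exists_le_resampleCount_le_of_slack (hx : ∀ j, 0 < x j ∧ x j < 1) {ε : ℝ}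
    (hε : 0 < ε) (hε1 : ε < 1)
    (h : ∀ j, I.probOf j ≤ (1 - ε) * x j * ∏ k ∈ I.coreNbr j, (1 - x k)) {s : ℕ} (hs : 0 < s) :
    I.tableLaw {R | ∃ l, I.IsLog R l ∧ ∃ i, s ≤ I.resampleCount l i} ≤
      ENNReal.ofReal ((1 - ε / 2) ^ s * (2 * (I.T x / ε))) := by
  have hx' : ∀ j, 0 < (1 - ε / 2) * x j ∧ (1 - ε / 2) * x j < 1 := fun j =>
    ⟨mul_pos (by linarith) (hx j).1, by nlinarith [hx j]⟩
  refine (tableLaw_exists_le_resampleCount_le hx' (η := ε / 2) (by linarith) (by linarith)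
    (fun j _ => (h j).trans ?_) hs).trans (ENNReal.ofReal_le_ofReal ?_)
  · refine mul_le_mul ?_ ?_ (prod_one_sub_pos hx _).le ?_
    -- This is `1 - ε ≤ (1 - ε / 2) ^ 2`: one factor scales `x j`, the other remains as slack `ε /
    -- 2`.
    · nlinarith [(hx j).1, mul_nonneg (sq_nonneg ε) (hx j).1.le]
    · exact Finset.prod_le_prod (fun k _ => by linarith [(hx k).2])
        fun k _ => by nlinarith [(hx k).1]
    · exact mul_nonneg (by linarith) (hx' j).1.le
  · refine mul_le_mul_of_nonneg_left ?_ (pow_nonneg (by linarith) _)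
    rw [T, Finset.sum_div, Finset.mul_sum]
    refine Finset.sum_le_sum fun j _ => ?_
    have h1 : ε / 2 ≤ 1 - (1 - ε / 2) * x j := by nlinarith [hx j]
    calc (1 - ε / 2) * x j / (1 - (1 - ε / 2) * x j) ≤ x j / (ε / 2) :=
          div_le_div₀ (hx j).1.le (by nlinarith [(hx j).1]) (by linarith) h1
      _ = 2 * (x j / ε) := by field_simp

theorem tableLaw_lt_resamplings_le (hx : ∀ j, 0 < x j ∧ x j < 1) {ε : ℝ}
    (hε : 0 < ε) (hε1 : ε < 1)
    (h : ∀ j, I.probOf j ≤ (1 - ε) * x j * ∏ k ∈ I.coreNbr j, (1 - x k)) {r : ℝ} (hr : 1 ≤ r) :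
    I.tableLaw {R | ENNReal.ofReal (r * (6 * I.v₂ x ε)) < (I.resamplings R : ℝ≥0∞)} ≤
      ENNReal.ofReal (Real.exp (-r)) := by
  set Q := 2 + I.T x / ε with hQ
  have hT : 0 ≤ I.T x / ε := div_nonneg (T_nonneg hx) hε.le
  set L := Real.logb 2 Q with hL
  have hL1 : 1 ≤ L := by
    rw [hL, Real.le_logb_iff_rpow_le one_lt_two (by linarith), Real.rpow_one]
    linarith
  have hlogQ : Real.log Q ≤ L := by
    rw [hL, Real.logb, le_div_iff₀ (Real.log_pos one_lt_two)]
    have := Real.log_nonneg (show 1 ≤ Q by linarith)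
    nlinarith [Real.log_two_lt_d9]
  -- The decay at `t` is `exp (-t * ε / 2) = exp (-3 * r * L)`. The prefactor `2 * T / ε` is at most
  -- `Q ^ 2 ≤ exp (2 * L)`, and `-3 * r * L + 2 * L ≤ -r` because `r` and `L` are at least `1`.
  let t : ℝ := 6 * r * L / ε
  have ht : 0 ≤ t := by positivity
  have hsub : {R | ENNReal.ofReal (r * (6 * I.v₂ x ε)) < (I.resamplings R : ℝ≥0∞)} ⊆
      {R | ∃ l, I.IsLog R l ∧ ∃ i, ⌊t⌋₊ + 1 ≤ I.resampleCount l i} := by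
    intro R hR
    have e : r * (6 * I.v₂ x ε) = I.n * t := by
      simp only [t, v₂, ← hQ, ← hL]
      ring
    rw [Set.mem_ofPred_eq, e, resamplings, ENat.toENNReal_iSup, lt_iSup_iff] at hR
    obtain ⟨⟨l, hl⟩, hlen⟩ := hR
    rw [ENat.toENNReal_coe, ← ENNReal.ofReal_natCast, ENNReal.ofReal_lt_ofReal_iff'] at hlen
    have hsum := length_le_sum_resampleCount hl (probOf_lt_one hx hε.le h)
    have hlt : ∑ _i : Fin I.n, t < ∑ i, (I.resampleCount l i : ℝ) := by
      have : (l.length : ℝ) ≤ ∑ i, (I.resampleCount l i : ℝ) := by exact_mod_cast hsum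
      simpa using hlen.1.trans_le this
    -- Pigeonhole: more than `n * t` resamplings, each touching a variable.
    obtain ⟨i, _, hi⟩ := Finset.exists_lt_of_sum_lt hlt
    exact ⟨l, hl, i, (Nat.floor_lt ht).2 hi⟩
  refine (measure_mono hsub).trans
    ((tableLaw_exists_le_resampleCount_le_of_slack hx hε hε1 h (Nat.succ_pos _)).trans
      (ENNReal.ofReal_le_ofReal ?_))
  have h1 : (1 - ε / 2) ^ (⌊t⌋₊ + 1) ≤ Real.exp (-(3 * r * L)) := by
    calc (1 - ε / 2) ^ (⌊t⌋₊ + 1) ≤ Real.exp (-(ε / 2)) ^ (⌊t⌋₊ + 1) :=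
          pow_le_pow_left₀ (by linarith) (Real.one_sub_le_exp_neg _) _
      _ = Real.exp (((⌊t⌋₊ + 1 : ℕ) : ℝ) * -(ε / 2)) := (Real.exp_nat_mul _ _).symm
      _ ≤ _ := by
          refine Real.exp_le_exp.2 ?_
          have h2 : t ≤ ((⌊t⌋₊ + 1 : ℕ) : ℝ) := by
            push_cast
            exact (Nat.lt_floor_add_one t).le
          have h3 : t * ε = 6 * r * L := by simp only [t]; field_simp
          nlinarith
  have h2 : 2 * (I.T x / ε) ≤ Real.exp (2 * L) := by
    calc 2 * (I.T x / ε) ≤ Q * Q := by nlinarith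
      _ = Real.exp (2 * Real.log Q) := by
        rw [two_mul, Real.exp_add, Real.exp_log (by linarith)]
      _ ≤ _ := Real.exp_le_exp.2 (by linarith)
  calc (1 - ε / 2) ^ (⌊t⌋₊ + 1) * (2 * (I.T x / ε))
      ≤ Real.exp (-(3 * r * L)) * Real.exp (2 * L) :=
        mul_le_mul h1 h2 (by positivity) (Real.exp_pos _).le
    _ = Real.exp (-(3 * r * L) + 2 * L) := (Real.exp_add _ _).symm
    _ ≤ Real.exp (-r) := Real.exp_le_exp.2 (by nlinarith)

theorem lintegral_resamplings_le_v₂ (hx : ∀ j, 0 < x j ∧ x j < 1) {ε : ℝ}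
    (hε : 0 < ε) (hε1 : ε < 1)
    (h : ∀ j, I.probOf j ≤ (1 - ε) * x j * ∏ k ∈ I.coreNbr j, (1 - x k)) :
    ∫⁻ R, (I.resamplings R : ℝ≥0∞) ∂I.tableLaw ≤ ENNReal.ofReal (12 * I.v₂ x ε) := by
  have := lintegral_le_of_exp_tail (f := fun R => (I.resamplings R : ℝ≥0∞))
    (mul_nonneg (by norm_num) (v₂_nonneg hx hε) : (0 : ℝ) ≤ 6 * I.v₂ x ε)
    fun r hr => tableLaw_lt_resamplings_le hx hε hε1 h hr
  refine this.trans_eq ?_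
  congr 1
  ring

theorem one_sub_exp_neg_le_tableLaw (hx : ∀ j, 0 < x j ∧ x j < 1) {ε : ℝ}
    (hε : 0 < ε) (hε1 : ε < 1)
    (h : ∀ j, I.probOf j ≤ (1 - ε) * x j * ∏ k ∈ I.coreNbr j, (1 - x k)) {r : ℝ} (hr : 1 ≤ r) :
    1 - Real.exp (-r) ≤ I.tableLaw.real
      {R | (I.resamplings R : ℝ≥0∞) ≤ ENNReal.ofReal (r * (12 * I.v₂ x ε))} := by
  refine one_sub_le_measureReal (Real.exp_pos _).le
    ((measure_mono fun R hR => ?_).trans (tableLaw_lt_resamplings_le hx hε hε1 h hr))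
  rw [Set.mem_compl_iff, Set.mem_ofPred_eq, not_le] at hR
  refine lt_of_le_of_lt (ENNReal.ofReal_le_ofReal ?_) hR
  have := v₂_nonneg (I := I) hx hε
  gcongr
  norm_num

end LLLInstance

/-! ## Programs: frame property and heights of stacks -/

namespace Prog

/-- A strict upper bound for the stacks that the program may change. -/
def bound : Prog → ℕ
  | skip => 0
  | push s _ => s + 1
  | pop s => s + 1
  | readInput s _ => s + 1
  | readValue s _ _ => s + 1
  | isVar s _ => s + 1
  | sample _ => 0
  | seq p q => max p.bound q.bound
  | ite _ p q => max p.bound q.bound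
  | .while _ p => p.bound

end Prog

namespace LLLInstance

variable {I : LLLInstance.{u, v}} (R : I.Table) (l : List I.J) {i : Fin I.n} {j : I.J}

theorem current_cons_of_mem (hi : i ∈ I.vbl j) :
    I.current R (j :: l) i = R (i, I.resampleCount l i + 1) := by
  have e := resampleCount_cons j l i
  rw [if_pos hi] at e
  exact congrArg (β := I.Ω i) (fun k : ℕ => R (i, k)) e

theorem current_cons_of_notMem (hi : i ∉ I.vbl j) :
    I.current R (j :: l) i = I.current R l i := by
  have e := resampleCount_cons j l i
  rw [if_neg hi, add_zero] at e
  exact congrArg (β := I.Ω i) (fun k : ℕ => R (i, k)) e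

end LLLInstance

section Machine

variable {I : LLLInstance.{u, v}} {P : Presentation I} {R : I.Table}

theorem MState.draw_stk (σ : MState I) (a : ℕ) : (σ.draw R a).stk = σ.stk := by
  unfold MState.draw
  split_ifs <;> rfl

theorem MState.setStk_stk_of_ne (σ : MState I) {s s' : ℕ} (l : List Bool) (h : s' ≠ s) :
    (σ.setStk s l).stk s' = σ.stk s' :=
  Function.update_of_ne h _ _

@[simp] theorem MState.setStk_stk_self (σ : MState I) (s : ℕ) (l : List Bool) :
    (σ.setStk s l).stk s = l :=
  Function.update_self _ _ _

theorem Runs.stk_eq {p : Prog} {σ σ' : MState I} {t : ℕ} (h : Runs P R p σ t σ') {s : ℕ}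
    (hs : p.bound ≤ s) : σ'.stk s = σ.stk s := by
  induction h with
  | skip | whileFalse => rfl
  | push | pop | readInput | readValue | isVar =>
    simp only [Prog.bound] at hs
    exact MState.setStk_stk_of_ne _ _ (by omega)
  | sample => rw [MState.draw_stk]
  | seq p q σ σ₁ σ₂ t₁ t₂ hp hq ihp ihq =>
    simp only [Prog.bound, max_le_iff] at hs
    rw [ihq hs.2, ihp hs.1]
  | iteTrue c p q σ σ' t hc hp ih =>
    simp only [Prog.bound, max_le_iff] at hs
    exact ih hs.1
  | iteFalse c p q σ σ' t hc hp ih =>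
    simp only [Prog.bound, max_le_iff] at hs
    exact ih hs.2
  | whileTrue c p σ σ₁ σ₂ t₁ t₂ hc hp hw ihp ihw => rw [ihw hs, ihp hs]

theorem MState.length_pushOpt_le (σ : MState I) (s' : ℕ) (b : Option Bool) (s : ℕ) :
    ((σ.pushOpt s' b).stk s).length ≤ (σ.stk s).length + 1 := by
  by_cases h : s = s'
  · subst h
    cases b <;> simp [MState.pushOpt]
  · rw [MState.pushOpt, MState.setStk_stk_of_ne _ _ h]
    omega

/-- A step pushes at most one bit. So the verifier leaves only low stacks behind, and clearing them
is cheap. -/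
theorem Runs.length_stk_le {p : Prog} {σ σ' : MState I} {t : ℕ} (h : Runs P R p σ t σ') (s : ℕ) :
    (σ'.stk s).length ≤ (σ.stk s).length + t := by
  induction h with
  | skip | whileFalse => omega
  | push | readInput | readValue | isVar => exact MState.length_pushOpt_le _ _ _ _
  | pop s' σ =>
    by_cases h : s = s'
    · subst h
      simp only [MState.setStk_stk_self, List.length_tail]
      omega
    · rw [MState.setStk_stk_of_ne _ _ h]
      omega
  | sample => rw [MState.draw_stk]; omega
  | seq | iteTrue | iteFalse | whileTrue => omega

/-! ## Clearing stacks -/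

/-- Empty the stacks with numbers below `k`. -/
def Prog.clear : ℕ → Prog
  | 0 => .skip
  | k + 1 => .seq (clear k) (.while (.nonempty k) (.pop k))

theorem runs_clearOne (s : ℕ) (l : List Bool) (σ : MState I) (h : σ.stk s = l) :
    Runs P R (.while (.nonempty s) (.pop s)) σ (2 * l.length + 1) (σ.setStk s []) := by
  induction l generalizing σ with
  | nil =>
    have e : σ.setStk s [] = σ := by
      rw [MState.setStk, ← h, Function.update_eq_self]
    rw [e]
    exact .whileFalse _ _ _ (by simp [StackTest.eval, h])
  | cons b l ih =>
    have hr := Runs.whileTrue (.nonempty s) (.pop s) σ _ _ 1 _ (by simp [StackTest.eval, h])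
      (Runs.pop s σ) (ih (σ.setStk s (σ.stk s).tail) (by simp [h]))
    have e : (σ.setStk s (σ.stk s).tail).setStk s [] = σ.setStk s [] := by
      simp [MState.setStk]
    rw [e] at hr
    convert hr using 1
    simp only [List.length_cons]
    ring

theorem runs_clear (k : ℕ) (σ : MState I) {H : ℕ} (hH : ∀ s < k, (σ.stk s).length ≤ H) :
    ∃ t ≤ k * (2 * H + 1) + 1, Runs P R (Prog.clear k) σ t
      { σ with stk := fun s => if s < k then [] else σ.stk s } := by
  induction k with
  | zero =>
    refine ⟨1, by simp, ?_⟩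
    simp only [Nat.not_lt_zero, if_false]
    exact Runs.skip σ
  | succ k ih =>
    obtain ⟨t, ht, hr⟩ := ih fun s hs => hH s (by omega)
    have hr' := Runs.seq _ _ _ _ _ _ _ hr (runs_clearOne k (σ.stk k) _ (by simp))
    have e : (MState.setStk { σ with stk := fun s => if s < k then [] else σ.stk s } k [])
        = { σ with stk := fun s => if s < k + 1 then [] else σ.stk s } := by
      unfold MState.setStk
      congr 1
      funext s
      by_cases hs : s = k
      · subst hs; simp
      · have : s < k + 1 ↔ s < k := by omega
        simp [hs, this]
    rw [e] at hr'
    refine ⟨_, ?_, hr'⟩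
    have := hH k (by omega)
    calc t + (2 * (σ.stk k).length + 1) ≤ (k * (2 * H + 1) + 1) + (2 * H + 1) := by omega
      _ = _ := by ring

/-! ## Resampling the variables given by a bit vector -/

/-- Draw new samples of the variables in the set whose bit vector is on stack `1`. The stack `c`
counts the variables. -/
def Prog.resample (c : ℕ) : Prog :=
  .while (.nonempty 1)
    (.seq (.ite (.top 1) (.sample c) .skip) (.seq (.pop 1) (.push c true)))

theorem MState.draw_val_drawn (σ : MState I) (a : ℕ) (i : Fin I.n) :
    (((σ.draw R a).val i, (σ.draw R a).drawn i) : I.Ω i × ℕ) =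
      if i.1 = a then (R (i, σ.drawn i), σ.drawn i + 1) else (σ.val i, σ.drawn i) := by
  unfold MState.draw
  split_ifs with h h' h'
  · subst h'
    simp
  · have : i ≠ ⟨a, h⟩ := fun e => h' (congrArg Fin.val e)
    simp [this]
  · exact absurd (h' ▸ i.2) h
  · rfl

/-- The height of stack `c` is the number of the variable that the top bit of stack `1` refers to;
it is arbitrary at the start so that the induction can advance it. Each bit costs five steps. -/
theorem runs_resample {c : ℕ} (hc : c ≠ 1) (L : List Bool) (σ : MState I) (hL : σ.stk 1 = L) :
    ∃ σ', Runs P R (Prog.resample c) σ (5 * L.length + 1) σ' ∧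
      (∀ s, s ≠ 1 → s ≠ c → σ'.stk s = σ.stk s) ∧ σ'.stk 1 = [] ∧
      (σ'.stk c).length = (σ.stk c).length + L.length ∧
      ∀ i : Fin I.n, ((σ'.val i, σ'.drawn i) : I.Ω i × ℕ) =
        if (σ.stk c).length ≤ i.1 ∧ L[i.1 - (σ.stk c).length]? = some true then
          (R (i, σ.drawn i), σ.drawn i + 1) else (σ.val i, σ.drawn i) := by
  induction L generalizing σ with
  | nil =>
    exact ⟨σ, .whileFalse _ _ _ (by simp [StackTest.eval, hL]), fun _ _ _ => rfl, hL, by simp,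
      by simp⟩
  | cons b L ih =>
    let σ₁ : MState I := if b then σ.draw R (σ.stk c).length else σ
    have hσ₁ : σ₁.stk = σ.stk := by
      simp only [σ₁]
      split_ifs
      exacts [MState.draw_stk _ _, rfl]
    have h₁ : Runs P R (.ite (.top 1) (.sample c) .skip) σ 2 σ₁ := by
      cases b with
      | true => exact .iteTrue _ _ _ _ _ 1 (by simp [StackTest.eval, hL]) (.sample c σ)
      | false => exact .iteFalse _ _ _ _ _ 1 (by simp [StackTest.eval, hL]) (.skip σ)
    let σ₂ : MState I := σ₁.setStk 1 (σ₁.stk 1).tail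
    let σ₃ : MState I := σ₂.pushOpt c (some true)
    have h₃ := Runs.seq _ _ _ _ _ _ _ h₁
      (Runs.seq _ _ _ _ _ _ _ (Runs.pop (P := P) (R := R) 1 σ₁) (Runs.push c true σ₂))
    have hstk1 : σ₃.stk 1 = L := by
      simp only [σ₃, σ₂, MState.pushOpt]
      rw [MState.setStk_stk_of_ne _ _ hc.symm, MState.setStk_stk_self, hσ₁, hL, List.tail_cons]
    have hstkc : σ₃.stk c = true :: σ.stk c := by
      change (σ₂.setStk c (true :: σ₂.stk c)).stk c = _
      rw [MState.setStk_stk_self, MState.setStk_stk_of_ne _ _ hc, hσ₁]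
    obtain ⟨σ', hr, hs, h1, hcc, hv⟩ := ih σ₃ hstk1
    refine ⟨σ', ?_, ?_, h1, ?_, ?_⟩
    · have := Runs.whileTrue (.nonempty 1) _ σ σ₃ σ' _ _ (by simp [StackTest.eval, hL]) h₃ hr
      rw [show 1 + (2 + (1 + 1)) + (5 * L.length + 1) = 5 * (b :: L).length + 1 by
        rw [List.length_cons]; ring] at this
      exact this
    · intro s hs1 hsc
      rw [hs s hs1 hsc]
      simp only [σ₃, σ₂, MState.pushOpt]
      rw [MState.setStk_stk_of_ne _ _ hsc, MState.setStk_stk_of_ne _ _ hs1, hσ₁]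
    · rw [hcc, hstkc, List.length_cons, List.length_cons]
      ring
    · intro i
      have e₃ : ((σ₃.val i, σ₃.drawn i) : I.Ω i × ℕ) =
          if b = true ∧ i.1 = (σ.stk c).length then (R (i, σ.drawn i), σ.drawn i + 1)
          else (σ.val i, σ.drawn i) := by
        change ((σ₁.val i, σ₁.drawn i) : I.Ω i × ℕ) = _
        cases b with
        | true => simpa [σ₁] using MState.draw_val_drawn (R := R) σ (σ.stk c).length i
        | false => simp [σ₁]
      rw [hv i, hstkc, List.length_cons]
      rcases lt_trichotomy i.1 (σ.stk c).length with hi | hi | hi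
      · rw [if_neg (by omega), if_neg (by omega), e₃, if_neg (by omega)]
      · rw [if_neg (by omega), e₃]
        simp [hi]
      · obtain ⟨k, hk⟩ := Nat.exists_eq_add_of_lt hi
        rw [if_neg (by omega), Prod.mk.injEq] at e₃
        have e₁ : i.1 - (σ.stk c).length = k + 1 := by omega
        have e₂ : i.1 - ((σ.stk c).length + 1) = k := by omega
        rw [e₁, e₂, List.getElem?_cons_succ, e₃.1, e₃.2]
        simp only [hi.le, Nat.succ_le_of_lt hi, true_and]

/-! ## Drawing the initial samples -/

/-- Write the bit vector of the set of all variables on stack `1`. The stack `c` counts the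
variables. -/
def Prog.allVars (c : ℕ) : Prog :=
  .seq (.isVar 1 c) (.seq (.while (.top 1) (.seq (.push c true) (.isVar 1 c)))
    (.seq (.pop 1) (.while (.nonempty c) (.pop c))))

/-- Here `k` variables remain to be counted. The positive answers of `isVar` pile up on stack `1`
and form the all-true vector; the final `false` on top is popped by `allVars`. -/
theorem runs_countVars {c : ℕ} (hc : c ≠ 1) (k : ℕ) (σ : MState I)
    (hk : (σ.stk c).length + k = I.n)
    (h1 : σ.stk 1 = decide (0 < k) :: List.replicate (σ.stk c).length true) :
    ∃ σ', Runs P R (.while (.top 1) (.seq (.push c true) (.isVar 1 c))) σ (3 * k + 1) σ' ∧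
      (∀ s, s ≠ 1 → s ≠ c → σ'.stk s = σ.stk s) ∧
      σ'.stk 1 = false :: List.replicate I.n true ∧
      (σ'.stk c).length = I.n ∧ σ'.val = σ.val ∧ σ'.drawn = σ.drawn := by
  induction k generalizing σ with
  | zero =>
    refine ⟨σ, .whileFalse _ _ _ (by simp [StackTest.eval, h1]), fun _ _ _ => rfl, ?_, hk, rfl, rfl⟩
    rw [h1, ← hk]
    simp
  | succ k ih =>
    let σ₁ : MState I := σ.pushOpt c (some true)
    let σ₂ : MState I := σ₁.pushOpt 1 (some (decide ((σ₁.stk c).length < I.n)))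
    have h₁c : σ₁.stk c = true :: σ.stk c := by simp [σ₁, MState.pushOpt]
    have h₁1 : σ₁.stk 1 = σ.stk 1 := MState.setStk_stk_of_ne _ _ hc.symm
    have h₂c : σ₂.stk c = true :: σ.stk c := by
      rw [← h₁c]
      exact MState.setStk_stk_of_ne _ _ hc
    have h₂1 : σ₂.stk 1 = decide (0 < k) :: List.replicate (σ₂.stk c).length true := by
      have e : ((σ.stk c).length + 1 < I.n) ↔ 0 < k := by omega
      rw [h₂c]
      simp only [σ₂, MState.pushOpt, MState.setStk_stk_self]
      rw [h₁1, h₁c, h1]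
      simp [e, List.replicate_succ]
    obtain ⟨σ', hr, hs, hs1, hsc, hv⟩ := ih σ₂ (by rw [h₂c, List.length_cons]; omega) h₂1
    refine ⟨σ', ?_, ?_, hs1, hsc, hv⟩
    · have := Runs.whileTrue (.top 1) _ σ σ₂ σ' _ _ (by simp [StackTest.eval, h1])
        (Runs.seq _ _ _ _ _ _ _ (Runs.push c true σ) (Runs.isVar 1 c σ₁)) hr
      convert this using 1
      ring
    · intro s h1 h2
      rw [hs s h1 h2]
      simp only [σ₂, σ₁, MState.pushOpt]
      rw [MState.setStk_stk_of_ne _ _ h1, MState.setStk_stk_of_ne _ _ h2]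

theorem runs_allVars {c : ℕ} (hc : c ≠ 1) (ω : I.Assignment) (d : Fin I.n → ℕ) :
    Runs P R (Prog.allVars c) (MState.blank ω d) (5 * I.n + 4)
      ((MState.blank ω d).setStk 1 (List.replicate I.n true)) := by
  let σ₀ : MState I := MState.blank ω d
  let σ₁ : MState I := σ₀.pushOpt 1 (some (decide ((σ₀.stk c).length < I.n)))
  have h₁c : σ₁.stk c = [] := MState.setStk_stk_of_ne _ _ hc
  obtain ⟨⟨stk, val, drawn⟩, hr, hs, hs1, hsc, rfl, rfl⟩ :=
    runs_countVars (P := P) (R := R) hc I.n σ₁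
    (by simp [h₁c]) (by
      rw [h₁c]
      simp [σ₁, σ₀, MState.pushOpt, MState.blank])
  simp only at hs hs1 hsc
  have h := Runs.seq _ _ _ _ _ _ _ (Runs.isVar 1 c σ₀) (Runs.seq _ _ _ _ _ _ _ hr
    (Runs.seq _ _ _ _ _ _ _ (Runs.pop 1 _) (runs_clearOne c _ _ rfl)))
  have et : 1 + (3 * I.n + 1 + (1 + (2 * (((⟨stk, val, drawn⟩ : MState I).setStk 1
      (stk 1).tail).stk c).length + 1))) = 5 * I.n + 4 := by
    rw [MState.setStk_stk_of_ne _ _ hc, hsc]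
    ring
  have eσ : ((⟨stk, val, drawn⟩ : MState I).setStk 1 (stk 1).tail).setStk c [] =
      (MState.blank val drawn).setStk 1 (List.replicate I.n true) := by
    unfold MState.setStk MState.blank
    congr 1
    funext s
    by_cases h1 : s = 1
    · subst h1
      simp [hc.symm, hs1]
    · by_cases h2 : s = c
      · subst h2
        simp [h1]
      · simp only [Function.update_of_ne h1, Function.update_of_ne h2]
        rw [hs s h1 h2]
        exact MState.setStk_stk_of_ne _ _ h1
  rw [et, eσ] at h
  exact h

/-! ## The implementation of the algorithm -/

/-- Draw new samples of the variables in the set whose bit vector is on stack `1`, empty the stacks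
and look for a core event that holds. -/
def Prog.round (V : Prog) (c : ℕ) : Prog :=
  .seq (.resample c) (.seq (.clear (c + 1)) V)

/-- The modified Moser–Tardos algorithm, with `V` to find a core event that holds. -/
def Prog.moserTardos (V : Prog) (c : ℕ) : Prog :=
  .seq (.allVars c) (.seq (V.round c) (.while (.top 0) (V.round c)))

/-- The state of the machine when the events in `l` have been resampled and `V` has been run. -/
structure Verified (R : I.Table) (c H : ℕ) (l : List I.J) (σ : MState I) : Prop where
  isLog : I.IsLog R l
  val_eq : σ.val = I.current R l
  drawn_eq : ∀ i, σ.drawn i = I.resampleCount l i + 1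
  stk_eq : ∀ s, c ≤ s → σ.stk s = []
  length_le : ∀ s, (σ.stk s).length ≤ H
  stk_one : (σ.stk 0).head? = some true → ∃ j ∈ I.core, I.current R l ∈ I.event j ∧
    ∀ i : Fin I.n, (σ.stk 1)[i.1]? = some true ↔ i ∈ I.vbl j
  length_one : (σ.stk 0).head? = some true → (σ.stk 1).length = I.n
  final : (σ.stk 0).head? ≠ some true → ∀ j ∈ I.core, I.current R l ∉ I.event j

/-- Hypothesis `hv` says that redrawing the marked variables produces the state belonging to `l`. In
this form the lemma covers both the initial sampling (`l = []`, all variables marked) and every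
later round. -/
theorem runs_round {V : Prog} {c H : ℕ} (hV : FindsCoreEvent P V H) (hVc : V.bound ≤ c)
    (hc : 2 ≤ c) (σ : MState I) (hstk : ∀ s, c ≤ s → σ.stk s = [])
    (hlen : ∀ s, (σ.stk s).length ≤ H + I.n) (h1 : (σ.stk 1).length = I.n) (l : List I.J)
    (hl : I.IsLog R l)
    (hv : ∀ i : Fin I.n, (if (σ.stk 1)[i.1]? = some true then
      (R (i, σ.drawn i), σ.drawn i + 1) else (σ.val i, σ.drawn i) : I.Ω i × ℕ) =
      (I.current R l i, I.resampleCount l i + 1)) :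
    ∃ t ≤ (5 * I.n + 1) + (((c + 1) * (2 * (H + I.n) + 1) + 1) + H), ∃ σ',
      Runs P R (V.round c) σ t σ' ∧ Verified R c H l σ' := by
  obtain ⟨σ₁, hr₁, hs, hs1, hsc, hv₁⟩ := runs_resample (P := P) (R := R) (c := c) (by omega) _ σ rfl
  have hsc' : σ.stk c = [] := hstk c le_rfl
  have hlen₁ : ∀ s, (σ₁.stk s).length ≤ H + I.n := by
    intro s
    by_cases hs1' : s = 1
    · rw [hs1', hs1]; simp
    by_cases hsc'' : s = c
    · rw [hsc'', hsc, hsc', h1]; simp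
    · rw [hs s hs1' hsc'']; exact hlen s
  obtain ⟨t₂, ht₂, hr₂⟩ := runs_clear (P := P) (R := R) (c + 1) σ₁ fun s _ => hlen₁ s
  have e : ({ σ₁ with stk := fun s => if s < c + 1 then [] else σ₁.stk s } : MState I) =
      MState.blank σ₁.val σ₁.drawn := by
    unfold MState.blank
    congr 1
    funext s
    split_ifs with h
    · rfl
    · rw [hs s (by omega) (by omega)]
      exact hstk s (by omega)
  rw [e] at hr₂
  have hv₂ : ∀ i, σ₁.val i = I.current R l i ∧ σ₁.drawn i = I.resampleCount l i + 1 := by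
    intro i
    have h := (hv₁ i).trans (by simpa [hsc'] using hv i)
    exact Prod.mk.inj h
  have hval : σ₁.val = I.current R l := funext fun i => (hv₂ i).1
  obtain ⟨k, σ₃, hk, hr₃, hval₃, hdr₃, hres⟩ := hV R σ₁.val σ₁.drawn
  refine ⟨_, ?_, σ₃, .seq _ _ _ _ _ _ _ hr₁ (.seq _ _ _ _ _ _ _ hr₂ hr₃), ?_⟩
  · rw [h1]; omega
  · refine ⟨hl, hval₃.trans hval, fun i => ?_, fun s hs => ?_, fun s => ?_, fun h0 => ?_,
      fun h0 => ?_, fun h0 => ?_⟩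
    · rw [hdr₃]; exact (hv₂ i).2
    · exact hr₃.stk_eq (hVc.trans hs)
    · have := hr₃.length_stk_le s
      simp only [MState.blank, List.length_nil] at this
      omega
    · rcases hres with ⟨j, hj, hjh, _, hj1⟩ | ⟨_, h⟩
      · refine ⟨j, hj, hval ▸ hjh, fun i => ?_⟩
        rw [hj1]
        simp
      · exact absurd h0 h
    · rcases hres with ⟨j, _, _, _, hj1⟩ | ⟨_, h⟩
      · rw [hj1, List.length_ofFn]
      · exact absurd h0 h
    · rcases hres with ⟨_, _, _, h, _⟩ | ⟨h, _⟩
      · exact absurd h h0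
      · exact hval ▸ h

/-- Induction on the number `m` of resamplings that the bound `N` still allows. The time estimate
charges one test and one round to each event added to the log, plus the last failing test. -/
theorem runs_loop {V : Prog} {c H : ℕ} (hV : FindsCoreEvent P V H) (hVc : V.bound ≤ c)
    (hc : 2 ≤ c) {N : ℕ} (hN : ∀ l, I.IsLog R l → l.length ≤ N) (m : ℕ) (l : List I.J)
    (hm : N ≤ l.length + m) (σ : MState I) (hσ : Verified R c H l σ) :
    ∃ (l' : List I.J) (t : ℕ) (σ' : MState I), I.IsFinalLog R l' ∧
      Runs P R (.while (.top 0) (V.round c)) σ t σ' ∧ σ'.val = I.current R l' ∧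
      t + (1 + ((5 * I.n + 1) + (((c + 1) * (2 * (H + I.n) + 1) + 1) + H))) * l.length ≤
        (1 + ((5 * I.n + 1) + (((c + 1) * (2 * (H + I.n) + 1) + 1) + H))) * l'.length + 1 := by
  set B := (5 * I.n + 1) + (((c + 1) * (2 * (H + I.n) + 1) + 1) + H) with hB
  induction m generalizing l σ with
  | zero =>
    by_cases h0 : (σ.stk 0).head? = some true
    · obtain ⟨j, hj, hjh, -⟩ := hσ.stk_one h0
      have := hN _ (.cons l j hσ.isLog hj hjh)
      rw [List.length_cons] at this
      omega
    · exact ⟨l, 1, σ, ⟨hσ.isLog, hσ.final h0⟩,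
        .whileFalse _ _ _ (by simpa [StackTest.eval] using h0), hσ.val_eq, by omega⟩
  | succ m ih =>
    by_cases h0 : (σ.stk 0).head? = some true
    · obtain ⟨j, hj, hjh, hj1⟩ := hσ.stk_one h0
      have hlog : I.IsLog R (j :: l) := .cons l j hσ.isLog hj hjh
      obtain ⟨t₁, ht₁, σ₁, hr₁, hσ₁⟩ := runs_round hV hVc hc σ hσ.stk_eq
        (fun s => (hσ.length_le s).trans (by omega)) (hσ.length_one h0) (j :: l) hlog (by
          intro i
          simp only [hj1 i]
          -- Sample `0` is the initial one, so a variable resampled `k` times has had `k + 1`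
          -- samples drawn, and its next sample is number `k + 1`.
          rw [hσ.val_eq, hσ.drawn_eq, LLLInstance.resampleCount_cons]
          split_ifs with hi
          · rw [LLLInstance.current_cons_of_mem R l hi]
          · rw [LLLInstance.current_cons_of_notMem R l hi, add_zero])
      obtain ⟨l', t, σ', hf, hr, hv, ht⟩ := ih (j :: l) (by rw [List.length_cons]; omega) σ₁ hσ₁
      refine ⟨l', 1 + t₁ + t, σ', hf,
        .whileTrue _ _ _ _ _ _ _ (by simpa [StackTest.eval] using h0) hr₁ hr, hv, ?_⟩
      rw [List.length_cons, mul_add, mul_one] at ht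
      omega
    · exact ⟨l, 1, σ, ⟨hσ.isLog, hσ.final h0⟩,
        .whileFalse _ _ _ (by simpa [StackTest.eval] using h0), hσ.val_eq, by omega⟩

theorem exists_length_le_of_resamplings_lt_top (h : I.resamplings R < ⊤) :
    ∃ N : ℕ, ∀ l, I.IsLog R l → l.length ≤ N := by
  obtain ⟨N, hN⟩ := ENat.ne_top_iff_exists.1 h.ne
  refine ⟨N, fun l hl => ?_⟩
  have := le_iSup (fun l : {l : List I.J // I.IsLog R l} => (l.1.length : ℕ∞)) ⟨l, hl⟩
  rw [show (⨆ l : {l : List I.J // I.IsLog R l}, (l.1.length : ℕ∞)) = N from hN.symm] at this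
  exact_mod_cast this

theorem runs_moserTardos {V : Prog} {c H : ℕ} (hV : FindsCoreEvent P V H) (hVc : V.bound ≤ c)
    (hc : 2 ≤ c) (h : I.resamplings R < ⊤) (ω : I.Assignment) :
    ∃ (l : List I.J) (t : ℕ) (σ : MState I), I.IsFinalLog R l ∧
      Runs P R (V.moserTardos c) (MState.blank ω fun _ => 0) t σ ∧ σ.val = I.current R l ∧
      t ≤ (10 * I.n + 8 + (c + 1) * (2 * (H + I.n) + 1) + H) * (l.length + 1) := by
  obtain ⟨N, hN⟩ := exists_length_le_of_resamplings_lt_top h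
  have hr₀ := runs_allVars (P := P) (R := R) (c := c) (by omega) ω fun _ => 0
  set σ₀ : MState I := (MState.blank ω fun _ => 0).setStk 1 (List.replicate I.n true) with hσ₀
  have h1 : σ₀.stk 1 = List.replicate I.n true := MState.setStk_stk_self _ _ _
  have hs : ∀ s, s ≠ 1 → σ₀.stk s = [] := fun s hs => MState.setStk_stk_of_ne _ _ hs
  obtain ⟨t₁, ht₁, σ₁, hr₁, hσ₁⟩ := runs_round (R := R) hV hVc hc σ₀ (fun s hcs => hs s (by omega))
    (fun s => by
      by_cases h : s = 1
      · rw [h, h1, List.length_replicate]; omega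
      · rw [hs s h]; simp)
    (by rw [h1, List.length_replicate]) [] .nil (by
      intro i
      rw [h1, List.getElem?_replicate, if_pos i.2, if_pos rfl]
      rfl)
  obtain ⟨l, t, σ, hf, hr, hv, ht⟩ := runs_loop hV hVc hc hN N [] (by simp) σ₁ hσ₁
  refine ⟨l, _, σ, hf, .seq _ _ _ _ _ _ _ hr₀ (.seq _ _ _ _ _ _ _ hr₁ hr), hv, ?_⟩
  rw [List.length_nil, mul_zero, add_zero] at ht
  set D := (c + 1) * (2 * (H + I.n) + 1)
  have hB : (1 + ((5 * I.n + 1) + ((D + 1) + H))) * l.length ≤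
      (10 * I.n + 8 + D + H) * l.length := Nat.mul_le_mul_right _ (by omega)
  rw [mul_add, mul_one]
  omega

theorem EfficientlyVerifiable.efficientlyImplementable {ι : Type w} {F : ι → LLLInstance.{u, v}}
    {P : ∀ a, Presentation (F a)} {size : ι → ℕ} (hn : ∀ a, (F a).n ≤ size a)
    (h : EfficientlyVerifiable F P size) : EfficientlyImplementable F P size := by
  obtain ⟨V, p, hV⟩ := h
  -- The counter must be out of reach of `V` and different from the stacks `0` and `1` that carry
  -- its answer.
  let c := max V.bound 2
  refine ⟨V.moserTardos c, 10 * Polynomial.X + 8 +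
    Polynomial.C (c + 1) * (2 * (p + Polynomial.X) + 1) + p, fun a R ω hR => ?_⟩
  obtain ⟨l, t, σ, hf, hr, hv, ht⟩ := runs_moserTardos (hV a) (le_max_left V.bound 2)
    (le_max_right V.bound 2) hR ω
  refine ⟨l, t, σ, hf, hr, hv, ht.trans (Nat.mul_le_mul_right _ ?_)⟩
  have := hn a
  simp only [Polynomial.eval_add, Polynomial.eval_mul, Polynomial.eval_ofNat, Polynomial.eval_X,
    Polynomial.eval_C, Polynomial.eval_one]
  gcongr

end Machine

/-! ### The theorem -/

theorem theorem3p3 :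
    ∃ C : ℝ, 0 < C ∧
      ∀ (ι : Type w) (F : ι → LLLInstance.{u, v}) (P : ∀ a, Presentation (F a)) (size : ι → ℕ),
        (∀ a, (F a).n ≤ size a) → EfficientlyVerifiable F P size →
        EfficientlyImplementable F P size ∧
        ∀ (a : ι) (ε : ℝ) (x : (F a).J → ℝ), 0 ≤ ε → ε < 1 → (∀ j, 0 < x j ∧ x j < 1) →
          (∀ j, (F a).probOf j ≤ (1 - ε) * x j * ∏ k ∈ (F a).coreNbr j, (1 - x k)) →
          ((∀ j ∈ (F a).core, ((F a).vbl j).Nonempty) →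
            (F a).T x ≤ (F a).n * max 1 (Real.logb 2 (1 / (F a).δ x))) ∧
          (ε = 0 →
            ∫⁻ R, ((F a).resamplings R : ℝ≥0∞) ∂(F a).tableLaw ≤ ENNReal.ofReal ((F a).v₁ x) ∧
            ∀ r : ℝ, 1 ≤ r →
              1 - 1 / r ≤ (F a).tableLaw.real
                {R | ((F a).resamplings R : ℝ≥0∞) ≤ ENNReal.ofReal (r * (F a).v₁ x)}) ∧
          (0 < ε →
            ∫⁻ R, ((F a).resamplings R : ℝ≥0∞) ∂(F a).tableLaw ≤
              ENNReal.ofReal (C * (F a).v₂ x ε) ∧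
            ∀ r : ℝ, 1 ≤ r →
              1 - Real.exp (-r) ≤ (F a).tableLaw.real
                {R | ((F a).resamplings R : ℝ≥0∞) ≤ ENNReal.ofReal (r * (C * (F a).v₂ x ε))}) ∧
          1 - ∑ j ∈ (F a).nonCore, x j ≤ (F a).tableLaw.real (F a).successSet := by
  -- The tail bound holds with constant `6`; integrating it doubles the constant.
  refine ⟨12, by norm_num, fun ι F P size hn hV =>
    ⟨hV.efficientlyImplementable hn, fun a ε x hε hε1 hx h => ?_⟩⟩
  have h' : ∀ j, (F a).probOf j ≤ x j * ∏ k ∈ (F a).coreNbr j, (1 - x k) := fun j => by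
    refine (h j).trans (mul_le_mul_of_nonneg_right ?_ (LLLInstance.prod_one_sub_pos hx _).le)
    nlinarith [(hx j).1]
  exact ⟨LLLInstance.T_le hx,
    fun _ => ⟨LLLInstance.lintegral_resamplings_le_v₁ hx fun j _ => h' j,
      fun r hr => LLLInstance.one_sub_inv_le_tableLaw hx (fun j _ => h' j) hr⟩,
    fun hε0 => ⟨LLLInstance.lintegral_resamplings_le_v₂ hx hε0 hε1 h,
      fun r hr => LLLInstance.one_sub_exp_neg_le_tableLaw hx hε0 hε1 h hr⟩,
    LLLInstance.one_sub_sum_le_tableLaw_successSet hx h'⟩
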